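/- Let $\Lambda$ be a discrete valuation ring with maximal ideal $(p)$. An embedding $(A\subset B)$ is a finite length $\Lambda$-module $B$ with a submodule $A$; isomorphisms are isomorphisms of the ambient modules carrying one submodule onto the other, and direct sums are taken componentwise. The embedding is a pole if $A$ is an indecomposable module and $(A\subset B)$ is not a direct sum of two nonzero embeddings (and is nonzero); it is empty if $A=0$. A tableau is an increasing sequence of partitions $[\gamma^{(0)},\gamma^{(1)},\dots,\gamma^{(r)}]$ (continued by $\gamma^{(r)}$), pictured as the Young diagram with columns of lengths the parts of $\gamma^{(r)}$, in which the boxes of $\gamma^{(e)}\setminus\gamma^{(e-1)}$ carry the entry $e$. Its shape is $\gamma^{(r)}\setminus\gamma^{(0)}$ and its content records how often each entry occurs. It is the tableau of $(A\subset B)$ if for each $i$ the parts of $\gamma^{(i)}$ are the lengths of the indecomposable summands of $B/p^iA$. It is a Littlewood–Richardson (LR) tableau if its entries are weakly increasing along rows and strictly increasing down columns and if, counted from the right up to any column (inclusive), there are at least as many entries $e$ as entries $e+1$, for all $e\ge1$. The union of tableaux is formed by taking, for each $i$, the union with multiplicities of the $i$-th partitions. For $1\le e\le f$ and $n\ge f-e+1$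 let $C(e,f)_n$ be the tableau consisting of one column of height $n$ whose lowest boxes carry the entries $e,\dots,f$ and whose other boxes are empty; these, and the columns without entries, are called columns. Let $\Gamma$, $\widetilde\Gamma$ be LR tableaux of the same shape and content. We say that $\widetilde\Gamma$ is obtained from $\Gamma$ by an increasing box move if there are integers $n>n'$, $1\le e\le f$, $e<e'$, $f<f'$ with $f-e=f'-e'$ and $n'\ge f-e+1$, and a finite family $S$ of columns, such that $\Gamma$ is the union of $C(e,f)_n$, $C(e',f')_{n'}$ and the columns in $S$, while $\widetilde\Gamma$ is the union of $C(e',f')_n$, $C(e,f)_{n'}$ and the columns in $S$. **Proposition.** Suppose $\widetilde\Gamma$ is obtained from $\Gamma$ by an increasing box move. Then there are poles $Q_1,\dots,Q_s$ ($s\ge 0$), $P_1,P_2,\widetilde P_1,\widetilde P_2$ and empty embeddings $E,\widetilde E$ such that $\Gamma$ is the tableau of $Q_1\oplus\dots\oplus Q_s\oplus P_1\oplus P_2\oplus E$, $\widetilde\Gamma$ is the tableau of $Q_1\oplus\dots\oplus Q_s\oplus \widetilde P_1\oplus\widetilde P_2\oplus\widetilde E$, and $P_i\not\cong\widetilde P_j$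 for all $i,j\in\{1,2\}$. That is, each of the two tableaux is the tableau of a sum of poles and an empty embedding, and these direct sum decompositions differ, up to isomorphism and order, in exactly two poles and perhaps in the empty embeddings. -/

import Mathlib

universe u

/-! ### Tableaux

Partitions are Young diagrams whose *columns* are the parts: the box `(i, j)` lies in row `i`
and column `j` (both counted from `0`), and the `j`-th part is `μ.colLen j`. -/

/-- A tableau `[γ⁽⁰⁾, γ⁽¹⁾, …, γ⁽ʳ⁾]`: an increasing, eventually constant sequence of Young
diagrams. The boxes of `γ⁽ᵉ⁾ \ γ⁽ᵉ⁻¹⁾` carry the entry `e`. A finite sequence is continued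
by its last term. -/
@[ext]
structure Tableau where
  diag : ℕ → YoungDiagram
  mono : Monotone diag
  stable : ∃ r, ∀ i, r ≤ i → diag i = diag r

namespace Tableau

/-- The boxes of `T` carrying the entry `e` (for `e ≥ 1`). -/
def boxes (T : Tableau) (e : ℕ) : Finset (ℕ × ℕ) :=
  (T.diag e).cells \ (T.diag (e - 1)).cells

/-- The number of entries `e` in the columns with index at least `c`. -/
def countRight (T : Tableau) (e c : ℕ) : ℕ :=
  ((T.boxes e).filter fun b => c ≤ b.2).card

/-- Littlewood-Richardson tableaux. That the entries increase weakly along rows and columns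
is built into the notion of an increasing sequence of diagrams. -/
structure IsLR (T : Tableau) : Prop where
  /-- Entries strictly increase in columns: no column contains an entry twice. -/
  column_strict : ∀ e j, (T.diag (e + 1)).colLen j ≤ (T.diag e).colLen j + 1
  /-- Lattice permutation property: counted from the right up to any column, there are at least
  as many entries `e` as entries `e + 1`. -/
  lattice : ∀ e, 1 ≤ e → ∀ c, T.countRight (e + 1) c ≤ T.countRight e c

/-- The same shape: equal inner diagrams `γ⁽⁰⁾` and equal outer diagrams `γ⁽ʳ⁾`. -/
def SameShape (S T : Tableau) : Prop :=
  S.diag 0 = T.diag 0 ∧ ∃ r, ∀ i, r ≤ i → S.diag i = T.diag i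

/-- The same content: every entry occurs equally often. -/
def SameContent (S T : Tableau) : Prop :=
  ∀ e, 1 ≤ e → (S.boxes e).card = (T.boxes e).card

/-- `T` is the (row-wise) union of the finite family `S` of tableaux: for every `i`, the parts of
the `i`-th partition of `T` are the parts of the `i`-th partitions of the members of `S`
put together, so that row lengths add up. -/
def IsUnion (T : Tableau) (S : Multiset Tableau) : Prop :=
  ∀ i r, (T.diag i).rowLen r = (S.map fun U => (U.diag i).rowLen r).sum

end Tableau

/-- The Young diagram consisting of a single column of `h` boxes. -/
def singleColumn (h : ℕ) : YoungDiagram where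
  cells := Finset.range h ×ˢ {0}
  isLowerSet := by
    rintro ⟨a, b⟩ ⟨c, d⟩ ⟨h1, h2⟩ hab
    simp only [Finset.coe_product, Finset.coe_range, Finset.coe_singleton, Set.mem_prod,
      Set.mem_Iio, Set.mem_singleton_iff] at hab h1 h2 ⊢
    omega

/-- The number of boxes of the column tableau `C(e,f)_n` which are empty or have an
entry `≤ i`. -/
def columnHeight (e f n i : ℕ) : ℕ :=
  if i < e then n - (f + 1 - e) else if i ≤ f then n - (f - i) else n

/-- The one-column tableau `C(e,f)_n` of height `n` whose lowest boxes have the entries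
`e, e + 1, …, f`, meaningful for `1 ≤ e ≤ f + 1` and `f + 1 - e ≤ n`. For `f + 1 = e` it is the
empty column of height `n`. -/
def columnTableau (e f n : ℕ) : Tableau where
  diag i := singleColumn (columnHeight e f n i)
  mono := by
    intro i j hij
    have h : columnHeight e f n i ≤ columnHeight e f n j := by
      unfold columnHeight
      split_ifs <;> omega
    rw [← YoungDiagram.cells_subset_iff]
    exact Finset.product_subset_product_left (Finset.range_mono h)
  stable := by
    refine ⟨e + f + 1, fun i hi => ?_⟩
    have h : columnHeight e f n i = columnHeight e f n (e + f + 1) := by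
      unfold columnHeight
      split_ifs <;> omega
    rw [h]

/-- Column tableaux: one column, with consecutive entries (possibly none) at the bottom. -/
def IsColumnTableau (T : Tableau) : Prop :=
  ∃ e f n : ℕ, 1 ≤ e ∧ e ≤ f + 1 ∧ f + 1 ≤ n + e ∧ 1 ≤ n ∧ T = columnTableau e f n

/-- `Γ'` is obtained from `Γ` by an increasing box move: both are Littlewood-Richardson
tableaux of the same shape and content, and are unions of columns which differ in exactly two
columns: `C(e,f)_n`, `C(e',f')_{n'}` in `Γ` are replaced by `C(e',f')_n`, `C(e,f)_{n'}` in `Γ'`,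
where `n > n'`, `e < e'` and `f - e = f' - e'`, so that the smallest entry of these columns is
in a higher position in `Γ'`. -/
structure IncreasingBoxMove (Γ Γ' : Tableau) : Prop where
  isLR : Γ.IsLR
  isLR' : Γ'.IsLR
  sameShape : Γ.SameShape Γ'
  sameContent : Γ.SameContent Γ'
  columns : ∃ (S : Multiset Tableau) (e f n e' f' n' : ℕ),
    (∀ C ∈ S, IsColumnTableau C) ∧
    1 ≤ e ∧ e ≤ f ∧ f + 1 ≤ n' + e ∧ n' < n ∧ e < e' ∧ f + e' = f' + e ∧
    Γ.IsUnion (columnTableau e f n ::ₘ columnTableau e' f' n' ::ₘ S) ∧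
    Γ'.IsUnion (columnTableau e' f' n ::ₘ columnTableau e f n' ::ₘ S)

/-! ### Embeddings of finite length modules -/

/-- An embedding `(A ⊂ B)` of a submodule in a finite length `Λ`-module. -/
structure ModEmbedding (Λ : Type u) [CommRing Λ] where
  B : Type u
  [addCommGroup : AddCommGroup B]
  [module : Module Λ B]
  finiteLength : IsFiniteLength Λ B
  A : Submodule Λ B

namespace ModEmbedding

attribute [instance] ModEmbedding.addCommGroup ModEmbedding.module

variable {Λ : Type u} [CommRing Λ]

/-- Isomorphism of embeddings: an isomorphism of the ambient modules carrying one submodule onto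
the other. -/
def Iso (E F : ModEmbedding Λ) : Prop :=
  ∃ φ : E.B ≃ₗ[Λ] F.B, E.A.map (φ : E.B →ₗ[Λ] F.B) = F.A

/-- The direct sum of two embeddings. -/
def prod (E F : ModEmbedding Λ) : ModEmbedding Λ where
  B := E.B × F.B
  finiteLength := by
    have hE := isFiniteLength_iff_isNoetherian_isArtinian.mp E.finiteLength
    have hF := isFiniteLength_iff_isNoetherian_isArtinian.mp F.finiteLength
    have := hE.1
    have := hE.2
    have := hF.1
    have := hF.2
    exact isFiniteLength_iff_isNoetherian_isArtinian.mpr ⟨inferInstance, inferInstance⟩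
  A := E.A.prod F.A

/-- The direct sum of a finite family of embeddings. -/
def sum {s : ℕ} (E : Fin s → ModEmbedding Λ) : ModEmbedding Λ where
  B := ∀ i, (E i).B
  finiteLength := by
    have hE := fun i => isFiniteLength_iff_isNoetherian_isArtinian.mp (E i).finiteLength
    have := fun i => (hE i).1
    have := fun i => (hE i).2
    exact isFiniteLength_iff_isNoetherian_isArtinian.mpr ⟨inferInstance, inferInstance⟩
  A := Submodule.pi Set.univ fun i => (E i).A

/-- The zero object. -/
def IsZero (E : ModEmbedding Λ) : Prop := Subsingleton E.B

/-- Indecomposable objects of the category of embeddings. -/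
def IsIndecomposable (E : ModEmbedding Λ) : Prop :=
  ¬ E.IsZero ∧ ∀ F G : ModEmbedding Λ, E.Iso (F.prod G) → F.IsZero ∨ G.IsZero

/-- Empty embeddings `(0 ⊂ B)`. -/
def IsEmptyEmb (E : ModEmbedding Λ) : Prop := E.A = ⊥

end ModEmbedding

/-- Indecomposable modules. -/
def IsIndecomposableModule (Λ : Type*) [CommRing Λ] (M : Type*) [AddCommGroup M] [Module Λ M] :
    Prop :=
  Nontrivial M ∧ ∀ F G : Submodule Λ M, IsCompl F G → F = ⊥ ∨ G = ⊥

namespace ModEmbedding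

variable {Λ : Type u} [CommRing Λ]

/-- Poles: embeddings `(A ⊂ B)` that are indecomposable with `A` an indecomposable module. -/
def IsPole (P : ModEmbedding Λ) : Prop :=
  IsIndecomposableModule Λ P.A ∧ P.IsIndecomposable

end ModEmbedding

/-- The finite length module `M` over the local ring `Λ` with maximal ideal `𝔪 = (p)` has type
`μ`: it is isomorphic to the direct sum of the cyclic modules `Λ ⧸ (pᵐ)`, where `m` runs over the
parts (column lengths) of `μ`. -/
def HasType (Λ : Type*) [CommRing Λ] [IsLocalRing Λ] (M : Type*) [AddCommGroup M] [Module Λ M]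
    (μ : YoungDiagram) : Prop :=
  Nonempty (M ≃ₗ[Λ] (∀ j : Fin (μ.rowLen 0), Λ ⧸ (IsLocalRing.maximalIdeal Λ) ^ μ.colLen j))

/-- `Γ` is the tableau of the embedding `(A ⊂ B)`: the `i`-th partition of `Γ` is the type of
`B ⧸ pⁱA`. -/
def Tableau.IsTableauOf {Λ : Type u} [CommRing Λ] [IsLocalRing Λ] (Γ : Tableau)
    (E : ModEmbedding Λ) : Prop :=
  ∀ i, HasType Λ (E.B ⧸ (IsLocalRing.maximalIdeal Λ ^ i • E.A)) (Γ.diag i)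

/-! A strictly increasing sequence `x 0 < … < x (m - 1)` is realized by a pole: A is generated by an
element a such that pⁱa has height `x i` in B. Its tableau arises from one-box columns, with the
entry i + 1 in row `x i`, by gluing boxes with consecutive entries in consecutive rows; each gluing
loses one entry-free column of height `x i + 1`. Hence B/pᵏA has `boxCount - mergeCount` parts
larger than r (`exists_pole_of_heights`).

It therefore suffices to cut the boxes of Γ into chains with the entries 1, …, m in strictly
descending rows, such that the boxes of a column stay together. Gluings inside a column are wanted;
a gluing between two different columns of a chain loses a column, which an empty embedding restores
(`exists_rowLen_eq`). The Littlewood–Richardson condition, read by rows, is Hall's condition for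
attaching columns that start with i + 2 below columns that end with i + 1.

The same chains must serve both tableaux. Index the columns by their entries, so that the move only
exchanges the heights of two columns X and Y: X moves up and Y moves down. At each entry the
matching is taken from the tableau in which the row conditions are the stronger ones, and it is then
valid in the other (`ColumnMove.exists_matching`). Only the chains through X and through Y change
their rows. These chains are distinct, and the heights of pᵏA at the smallest entries of X and Y
distinguish the old poles from the new ones. -/

/-! ### Counting cyclic summands of finite length modules. -/

/-- The finite length module `M` is a direct sum of nonzero cyclic modules `Λ ⧸ (pᶜ)`, and `f r`
of the exponents `c` are larger than `r`. -/
def HasCount (Λ : Type*) [CommRing Λ] [IsLocalRing Λ] (M : Type*) [AddCommGroup M] [Module Λ M]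
    (f : ℕ → ℕ) : Prop :=
  ∃ (ι : Type) (_ : Fintype ι) (c : ι → ℕ), (∀ j, 0 < c j) ∧
    Nonempty (M ≃ₗ[Λ] (∀ j, Λ ⧸ IsLocalRing.maximalIdeal Λ ^ c j)) ∧
    ∀ r, f r = Fintype.card {j // r < c j}

theorem Fintype.card_lt_eq_add {ι : Type*} [Fintype ι] (c : ι → ℕ) (w : ℕ) :
    Fintype.card {j // w < c j}
      = Fintype.card {j // c j = w + 1} + Fintype.card {j // w + 1 < c j} := by
  classical
  simp only [Fintype.card_subtype]
  rw [← Finset.card_union_of_disjoint]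
  · congr 1
    ext j
    simp only [Finset.mem_filter, Finset.mem_univ, true_and, Finset.mem_union]
    omega
  · rw [Finset.disjoint_left]
    intro j
    simp only [Finset.mem_filter, Finset.mem_univ, true_and]
    omega

theorem Fintype.card_fiber_eq_of_card_lt {ι κ : Type*} [Fintype ι] [Fintype κ] {c : ι → ℕ}
    {d : κ → ℕ} (hc : ∀ j, 0 < c j) (hd : ∀ j, 0 < d j)
    (h : ∀ r, Fintype.card {j // r < c j} = Fintype.card {j // r < d j}) (v : ℕ) :
    Fintype.card {j // c j = v} = Fintype.card {j // d j = v} := by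
  cases v with
  | zero =>
    have : IsEmpty {j // c j = 0} := ⟨fun j => (hc j.1).ne' j.2⟩
    have : IsEmpty {j // d j = 0} := ⟨fun j => (hd j.1).ne' j.2⟩
    simp
  | succ w =>
    have h1 := Fintype.card_lt_eq_add c w
    have h2 := Fintype.card_lt_eq_add d w
    rw [h w, h (w + 1)] at h1
    omega

section

variable {Λ : Type*} [CommRing Λ] [IsLocalRing Λ]
variable {M N : Type*} [AddCommGroup M] [Module Λ M] [AddCommGroup N] [Module Λ N]

theorem HasCount.of_equiv {f : ℕ → ℕ} (h : HasCount Λ N f) (e : M ≃ₗ[Λ] N) : HasCount Λ M f := by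
  obtain ⟨ι, _, c, hc, ⟨φ⟩, hf⟩ := h
  exact ⟨ι, _, c, hc, ⟨e.trans φ⟩, hf⟩

theorem HasCount.of_surjective {f : ℕ → ℕ} (h : HasCount Λ N f) (φ : M →ₗ[Λ] N)
    (hφ : Function.Surjective φ) {K : Submodule Λ M} (hK : K = LinearMap.ker φ) :
    HasCount Λ (M ⧸ K) f := by
  subst hK
  exact h.of_equiv (φ.quotKerEquivOfSurjective hφ)

theorem hasCount_zero [Subsingleton M] : HasCount Λ M 0 := by
  refine ⟨Empty, inferInstance, fun _ => 1, by simp, ⟨?_⟩, by simp⟩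
  exact { (0 : M →ₗ[Λ] _) with
    invFun := 0
    left_inv := fun x => Subsingleton.elim _ _
    right_inv := fun x => Subsingleton.elim _ _ }

theorem hasCount_cyclic (c : ℕ) :
    HasCount Λ (Λ ⧸ IsLocalRing.maximalIdeal Λ ^ c) fun r => if r < c then 1 else 0 := by
  rcases Nat.eq_zero_or_pos c with rfl | hc
  · have : Subsingleton (Λ ⧸ IsLocalRing.maximalIdeal Λ ^ 0) := by
      rw [Ideal.Quotient.subsingleton_iff]
      simp
    exact hasCount_zero
  · refine ⟨Unit, inferInstance, fun _ => c, fun _ => hc,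
      ⟨(LinearEquiv.funUnique Unit Λ (Λ ⧸ IsLocalRing.maximalIdeal Λ ^ c)).symm⟩, fun r => ?_⟩
    rw [Fintype.card_subtype]
    by_cases h : r < c <;> simp [h]

theorem HasCount.prod {f g : ℕ → ℕ} (hf : HasCount Λ M f) (hg : HasCount Λ N g) :
    HasCount Λ (M × N) (f + g) := by
  obtain ⟨ι, _, c, hc, ⟨φ⟩, hf⟩ := hf
  obtain ⟨κ, _, d, hd, ⟨ψ⟩, hg⟩ := hg
  refine ⟨ι ⊕ κ, inferInstance, Sum.elim c d, by rintro (j | j) <;> simp [hc, hd], ⟨?_⟩, ?_⟩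
  · exact (φ.prodCongr ψ).trans (LinearEquiv.sumPiEquivProdPi Λ ι κ
      fun s => Λ ⧸ IsLocalRing.maximalIdeal Λ ^ Sum.elim c d s).symm
  · intro r
    rw [Pi.add_apply, hf, hg, ← Fintype.card_sum]
    exact Fintype.card_congr (Equiv.subtypeSum (p := fun j => r < Sum.elim c d j)).symm

theorem HasCount.pi {s : ℕ} {M : Fin s → Type*} [∀ i, AddCommGroup (M i)] [∀ i, Module Λ (M i)]
    {f : Fin s → ℕ → ℕ} (hf : ∀ i, HasCount Λ (M i) (f i)) :
    HasCount Λ (∀ i, M i) fun r => ∑ i, f i r := by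
  choose ι _ c hc φ hf using hf
  refine ⟨Σ i, ι i, inferInstance, fun j => c j.1 j.2, fun j => hc _ _, ⟨?_⟩, ?_⟩
  · exact (LinearEquiv.piCongrRight fun i => (φ i).some).trans
      (LinearEquiv.piCurry Λ fun i j => Λ ⧸ IsLocalRing.maximalIdeal Λ ^ c i j).symm
  · intro r
    simp only [hf]
    rw [← Fintype.card_sigma]
    exact Fintype.card_congr
      { toFun := fun x => ⟨⟨x.1, x.2.1⟩, x.2.2⟩
        invFun := fun x => ⟨x.1.1, ⟨x.1.2, x.2⟩⟩
        left_inv := fun _ => rfl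
        right_inv := fun _ => rfl }

/-- Differences of the counts give the multiplicity of every exponent, so the summands can be
matched with the columns of `μ` by a bijection. Positive exponents are essential here: trivial
summands are invisible to the counts. -/
theorem HasCount.hasType {f : ℕ → ℕ} (h : HasCount Λ M f) {μ : YoungDiagram}
    (hμ : ∀ r, μ.rowLen r = f r) : HasType Λ M μ := by
  obtain ⟨ι, _, c, hc, ⟨φ⟩, hf⟩ := h
  have hcol : ∀ j : Fin (μ.rowLen 0), 0 < μ.colLen j := fun j =>
    YoungDiagram.mem_iff_lt_colLen.mp (YoungDiagram.mem_iff_lt_rowLen.mpr j.2)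
  have hcard : ∀ r, Fintype.card {j : Fin (μ.rowLen 0) // r < μ.colLen j}
      = Fintype.card {j // r < c j} := by
    intro r
    rw [← hf, ← hμ]
    refine (Fintype.card_congr ?_).trans (Fintype.card_fin _)
    exact
      { toFun := fun j => ⟨j.1, YoungDiagram.mem_iff_lt_rowLen.mp
          (YoungDiagram.mem_iff_lt_colLen.mpr j.2)⟩
        invFun := fun j => ⟨⟨j, j.2.trans_le (μ.rowLen_anti 0 r (Nat.zero_le r))⟩,
          YoungDiagram.mem_iff_lt_colLen.mp (YoungDiagram.mem_iff_lt_rowLen.mpr j.2)⟩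
        left_inv := fun _ => rfl
        right_inv := fun _ => rfl }
  let σ : ι ≃ Fin (μ.rowLen 0) := Equiv.ofFiberEquiv (f := c) (g := fun j => μ.colLen j) fun v =>
    Fintype.equivOfCardEq (Fintype.card_fiber_eq_of_card_lt hc hcol (fun r => (hcard r).symm) v)
  have hσ : ∀ i, μ.colLen (σ i) = c i := fun i =>
    Equiv.ofFiberEquiv_map (f := c) (g := fun j : Fin (μ.rowLen 0) => μ.colLen j) _ i
  refine ⟨φ.trans ((LinearEquiv.piCongrRight fun i => ?_).trans
    (LinearEquiv.piCongrLeft Λ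
      (fun j : Fin (μ.rowLen 0) => Λ ⧸ IsLocalRing.maximalIdeal Λ ^ μ.colLen j) σ))⟩
  exact Submodule.quotEquivOfEq _ _ (by rw [hσ])

end

/-! ### Additivity of the counts under direct sums of embeddings. -/

namespace ModEmbedding

variable {Λ : Type u} [CommRing Λ]

theorem smul_prod {M N : Type*} [AddCommGroup M] [Module Λ M] [AddCommGroup N] [Module Λ N]
    (I : Ideal Λ) (A : Submodule Λ M) (A' : Submodule Λ N) :
    I • A.prod A' = (I • A).prod (I • A') := by
  apply le_antisymm
  · rw [Submodule.smul_le]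
    intro r hr x hx
    exact ⟨Submodule.smul_mem_smul hr hx.1, Submodule.smul_mem_smul hr hx.2⟩
  · rw [Submodule.prod_le_iff, Submodule.map_smul'', Submodule.map_smul'']
    constructor
    · apply Submodule.smul_mono le_rfl
      rintro _ ⟨x, hx, rfl⟩
      exact ⟨hx, A'.zero_mem⟩
    · apply Submodule.smul_mono le_rfl
      rintro _ ⟨x, hx, rfl⟩
      exact ⟨A.zero_mem, hx⟩

theorem smul_pi {s : ℕ} {M : Fin s → Type*} [∀ i, AddCommGroup (M i)] [∀ i, Module Λ (M i)]
    (I : Ideal Λ) (A : ∀ i, Submodule Λ (M i)) :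
    I • Submodule.pi Set.univ A = Submodule.pi Set.univ fun i => I • A i := by
  apply le_antisymm
  · rw [Submodule.smul_le]
    intro r hr x hx i _
    exact Submodule.smul_mem_smul hr (hx i trivial)
  · intro x hx
    rw [← Finset.univ_sum_single x]
    refine Submodule.sum_mem _ fun i _ => ?_
    have h : (I • A i).map (LinearMap.single Λ M i) ≤ I • Submodule.pi Set.univ A := by
      rw [Submodule.map_smul'']
      apply Submodule.smul_mono le_rfl
      rintro _ ⟨y, hy, rfl⟩ j _
      rcases eq_or_ne j i with rfl | hj
      · simpa using hy
      · simp [hj]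
    exact h ⟨x i, hx i trivial, rfl⟩

variable [IsLocalRing Λ]

/-- The quotient `B ⧸ pᵏA` is a direct sum of cyclic modules, `F k r` of which have length larger
than `r`. -/
def HasCounts (E : ModEmbedding Λ) (F : ℕ → ℕ → ℕ) : Prop :=
  ∀ k, HasCount Λ (E.B ⧸ (IsLocalRing.maximalIdeal Λ ^ k • E.A)) (F k)

theorem HasCounts.prod {E E' : ModEmbedding Λ} {F F' : ℕ → ℕ → ℕ} (h : E.HasCounts F)
    (h' : E'.HasCounts F') : (E.prod E').HasCounts (F + F') := by
  intro k
  refine ((h k).prod (h' k)).of_surjective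
    ((Submodule.mkQ _).prodMap (Submodule.mkQ _)) ?_ ?_
  · exact Function.Surjective.prodMap (Submodule.mkQ_surjective _) (Submodule.mkQ_surjective _)
  · rw [LinearMap.ker_prodMap, Submodule.ker_mkQ, Submodule.ker_mkQ]
    exact smul_prod _ _ _

theorem HasCounts.sum {s : ℕ} {E : Fin s → ModEmbedding Λ} {F : Fin s → ℕ → ℕ → ℕ}
    (h : ∀ i, (E i).HasCounts (F i)) : (ModEmbedding.sum E).HasCounts fun k r => ∑ i, F i k r := by
  intro k
  refine (HasCount.pi fun i => h i k).of_equiv ?_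
  exact (Submodule.quotEquivOfEq _ _ (smul_pi _ _)).trans (Submodule.quotientPi _)

theorem HasCounts.isTableauOf {E : ModEmbedding Λ} {F : ℕ → ℕ → ℕ} (h : E.HasCounts F)
    {Γ : Tableau} (hΓ : ∀ k r, (Γ.diag k).rowLen r = F k r) : Γ.IsTableauOf E :=
  fun k => (h k).hasType (hΓ k)

end ModEmbedding

/-! ### Construction of a cyclic submodule with a prescribed height sequence. -/

section

variable {Λ : Type u} [CommRing Λ] [IsDomain Λ] [IsDiscreteValuationRing Λ]

open IsLocalRing

theorem isFiniteLength_quotient_maximalIdeal_pow (n : ℕ) :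
    IsFiniteLength Λ (Λ ⧸ maximalIdeal Λ ^ n) := by
  obtain ⟨ϖ, h⟩ := IsDiscreteValuationRing.exists_irreducible Λ
  rw [h.maximalIdeal_eq, Ideal.span_singleton_pow]
  exact isFiniteLength_quotient_span_singleton Λ
    (mem_nonZeroDivisors_of_ne_zero (pow_ne_zero _ h.ne_zero))

theorem IsFiniteLength.prod {R M N : Type*} [Ring R] [AddCommGroup M] [Module R M] [AddCommGroup N]
    [Module R N] (hM : IsFiniteLength R M) (hN : IsFiniteLength R N) :
    IsFiniteLength R (M × N) := by
  rw [isFiniteLength_iff_isNoetherian_isArtinian] at *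
  obtain ⟨_, _⟩ := hM
  obtain ⟨_, _⟩ := hN
  exact ⟨inferInstance, inferInstance⟩

theorem mk_maximalIdeal_pow_eq_zero {ϖ : Λ} (h : Irreducible ϖ) {n : ℕ} {s : Λ} :
    Submodule.Quotient.mk (p := maximalIdeal Λ ^ n) s = 0 ↔ ∃ t, s = ϖ ^ n * t := by
  rw [Submodule.Quotient.mk_eq_zero, h.maximalIdeal_eq, Ideal.span_singleton_pow,
    Ideal.mem_span_singleton]
  rfl

theorem pow_smul_quotient_eq_zero {ϖ : Λ} (h : Irreducible ϖ) (n : ℕ)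
    (s : Λ ⧸ maximalIdeal Λ ^ n) : ϖ ^ n • s = 0 := by
  obtain ⟨s, rfl⟩ := Submodule.Quotient.mk_surjective _ s
  rw [← Submodule.Quotient.mk_smul, mk_maximalIdeal_pow_eq_zero h]
  exact ⟨s, rfl⟩

/-- The number of `i` such that `x` jumps only by one from `i` to `i + 1` and such that
`x i ≥ r`. -/
def mergeCount (m : ℕ) (x : ℕ → ℕ) (r : ℕ) : ℕ :=
  ∑ i ∈ Finset.range m, if i + 1 < m ∧ x (i + 1) = x i + 1 ∧ r < x i + 1 then 1 else 0

/-- The number of `i < m` such that the one-box column with the entry `i + 1` in row `x i` has more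
than `r` boxes which are empty or have an entry at most `k`. -/
def boxCount (m : ℕ) (x : ℕ → ℕ) (k r : ℕ) : ℕ :=
  ∑ i ∈ Finset.range m, if r < x i + (if i < k then 1 else 0) then 1 else 0

theorem mergeCount_succ (m : ℕ) (x : ℕ → ℕ) (r : ℕ) :
    mergeCount (m + 1) x r = mergeCount m (fun i => x (i + 1)) r
      + if 0 < m ∧ x 1 = x 0 + 1 ∧ r < x 0 + 1 then 1 else 0 := by
  rw [mergeCount, Finset.sum_range_succ']
  simp only [mergeCount, zero_add, Nat.add_lt_add_iff_right, Nat.lt_add_left_iff_pos]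

theorem boxCount_succ_succ (m : ℕ) (x : ℕ → ℕ) (k r : ℕ) :
    boxCount (m + 1) x (k + 1) r = boxCount m (fun i => x (i + 1)) k r
      + if r < x 0 + 1 then 1 else 0 := by
  rw [boxCount, Finset.sum_range_succ']
  simp only [boxCount, Nat.add_lt_add_iff_right, Nat.zero_lt_succ, if_true]

theorem boxCount_succ_zero (m : ℕ) (x : ℕ → ℕ) (r : ℕ) :
    boxCount (m + 1) x 0 r = boxCount m (fun i => x (i + 1)) 0 r
      + if r < x 0 then 1 else 0 := by
  rw [boxCount, Finset.sum_range_succ']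
  simp only [boxCount, Nat.not_lt_zero, if_false, add_zero]

/-- The module `B` with the element `u` realizes the height sequence `x 0, …, x (m - 1)`: the
submodule generated by `a = pˣ⁽⁰⁾u` is the submodule of the pole in which `pⁱa` has height `x i`. -/
structure IsHeightModel (ϖ : Λ) (m : ℕ) (x : ℕ → ℕ) (B : Type u) [AddCommGroup B] [Module Λ B]
    (u : B) : Prop where
  finiteLength : IsFiniteLength Λ B
  torsion : ∃ n, ∀ b : B, ϖ ^ n • b = 0
  zero : m = 0 → Subsingleton B
  -- The generator may be replaced by a higher multiple of u. This strengthening is needed when a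
  -- height `x 0 - 1` is later prepended without changing B.
  top : ∀ y ≤ x 0, ∃ g : ℕ → ℕ, HasCount Λ (B ⧸ Submodule.span Λ {ϖ ^ y • u}) g ∧
    ∀ r, g r + mergeCount m x r = boxCount m (fun i => if i = 0 then y else x i) 0 r
  quot : ∀ k, ∃ g : ℕ → ℕ, HasCount Λ (B ⧸ Submodule.span Λ {ϖ ^ k • ϖ ^ x 0 • u}) g ∧
    ∀ r, g r + mergeCount m x r = boxCount m x k r
  -- This is the source of indecomposability: modulo A, the height of a socle element can always be
  -- raised.
  socle : ∀ (h : ℕ) (z : B), ϖ • z = 0 → (∃ b, z = ϖ ^ h • b) →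
    ∃ t ∈ Submodule.span Λ {ϖ ^ x 0 • u}, ∃ b, z - t = ϖ ^ (h + 1) • b
  height : ∀ k < m, ∃ b, ϖ ^ k • ϖ ^ x 0 • u = ϖ ^ x k • b
  not_height : ∀ k < m, ¬ ∃ b, ϖ ^ k • ϖ ^ x 0 • u = ϖ ^ (x k + 1) • b

theorem isHeightModel_zero (ϖ : Λ) (x : ℕ → ℕ) : IsHeightModel ϖ 0 x PUnit (0 : PUnit.{u + 1}) where
  finiteLength := IsFiniteLength.of_subsingleton
  torsion := ⟨0, fun _ => rfl⟩
  zero _ := inferInstance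
  top y _ := ⟨0, hasCount_zero, fun r => by simp [mergeCount, boxCount]⟩
  quot k := ⟨0, hasCount_zero, fun r => by simp [mergeCount, boxCount]⟩
  socle h z _ _ := ⟨0, Submodule.zero_mem _, 0, rfl⟩
  height k hk := by omega
  not_height k hk := by omega

variable {ϖ : Λ} {m : ℕ} {x : ℕ → ℕ} {B : Type u} [AddCommGroup B] [Module Λ B]

/-- When the first jump is one, B and u are kept and only the generator is divided by p. In the
count, the new one-box column of the old first entry cancels against the new merge term. -/
theorem IsHeightModel.cons_merge {u : B}
    (H : IsHeightModel ϖ m (fun i => x (i + 1)) B u) (hm : 0 < m) (hx : x 1 = x 0 + 1) :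
    IsHeightModel ϖ (m + 1) x B u := by
  have ha : ∀ k, ϖ ^ (k + 1) • ϖ ^ x 0 • u = ϖ ^ k • ϖ ^ x 1 • u := by
    intro k
    rw [hx, smul_smul, smul_smul, ← pow_add, ← pow_add]
    congr 2
    omega
  have htop : ∀ y ≤ x 0, ∃ g : ℕ → ℕ, HasCount Λ (B ⧸ Submodule.span Λ {ϖ ^ y • u}) g ∧
      ∀ r, g r + mergeCount (m + 1) x r
        = boxCount (m + 1) (fun i => if i = 0 then y else x i) 0 r := by
    intro y hy
    obtain ⟨g, hg, h⟩ := H.top y (by simp; omega)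
    refine ⟨g, hg, fun r => ?_⟩
    have := h r
    obtain ⟨m, rfl⟩ := Nat.exists_eq_succ_of_ne_zero hm.ne'
    rw [mergeCount_succ, boxCount_succ_zero]
    simp only [Nat.succ_eq_add_one, boxCount_succ_zero] at this ⊢
    simp only [Nat.zero_lt_succ, hx, true_and, Nat.add_eq_zero_iff, one_ne_zero, and_false,
      if_false, if_true, zero_add] at this ⊢
    omega
  refine ⟨H.finiteLength, H.torsion, by simp, htop, ?_, ?_, ?_, ?_⟩
  · rintro (_ | k)
    · obtain ⟨g, hg, h⟩ := htop (x 0) le_rfl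
      refine ⟨g, by rwa [pow_zero, one_smul], fun r => (h r).trans ?_⟩
      congr 1
      ext i
      split_ifs with hi <;> simp [hi]
    · obtain ⟨g, hg, h⟩ := H.quot k
      rw [ha]
      refine ⟨g, hg, fun r => ?_⟩
      have := h r
      rw [mergeCount_succ, boxCount_succ_succ]
      simp only [hm, hx, true_and]
      omega
  · intro h z hz hb
    obtain ⟨t, ht, b⟩ := H.socle h z hz hb
    refine ⟨t, ?_, b⟩
    have := ha 0
    simp only [zero_add, pow_one, pow_zero, one_smul] at this
    refine Submodule.span_le.mpr ?_ ht
    rw [Set.singleton_subset_iff]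
    change ϖ ^ x 1 • u ∈ _
    rw [← this]
    exact Submodule.smul_mem _ _ (Submodule.mem_span_singleton_self _)
  · rintro (_ | k) hk
    · exact ⟨u, by simp⟩
    · obtain ⟨b, hb⟩ := H.height k (by omega)
      exact ⟨b, by rw [ha]; exact hb⟩
  · rintro (_ | k) hk ⟨b, hb⟩
    · refine H.not_height 0 hm ⟨b, ?_⟩
      change ϖ ^ 0 • ϖ ^ x 1 • u = ϖ ^ (x 1 + 1) • b
      rw [← ha, zero_add, pow_one]
      rw [pow_zero, one_smul] at hb
      rw [hb, smul_smul, ← pow_succ', hx]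
    · refine H.not_height k (by omega) ⟨b, ?_⟩
      rw [ha] at hb
      exact hb

/-- The quotient of `Λ ⧸ (pˣ⁺¹) × B` by the submodule generated by `pʸ(1, w)`. -/
theorem hasCount_quotient_span_pair (hϖ : Irreducible ϖ) {u w : B} {x₀ x₁ y : ℕ} (hy : y ≤ x₀)
    (hw : ϖ ^ (x₀ + 1) • w = ϖ ^ x₁ • u) {g : ℕ → ℕ}
    (hg : HasCount Λ (B ⧸ Submodule.span Λ {ϖ ^ x₁ • u}) g) :
    HasCount Λ (((Λ ⧸ maximalIdeal Λ ^ (x₀ + 1)) × B) ⧸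
      Submodule.span Λ {ϖ ^ y • ((Submodule.Quotient.mk 1, w) : (Λ ⧸ maximalIdeal Λ ^ (x₀ + 1)) × B)})
      ((fun r => if r < y then 1 else 0) + g) := by
  have hle : maximalIdeal Λ ^ (x₀ + 1) ≤ maximalIdeal Λ ^ y := Ideal.pow_le_pow_right (by omega)
  let q := Submodule.mkQ (Submodule.span Λ {ϖ ^ x₁ • u})
  have hker : maximalIdeal Λ ^ (x₀ + 1) ≤ LinearMap.ker (LinearMap.toSpanSingleton Λ _ (q w)) := by
    rw [hϖ.maximalIdeal_eq, Ideal.span_singleton_pow, Ideal.span_singleton_le_iff_mem,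
      LinearMap.mem_ker, LinearMap.toSpanSingleton_apply, ← map_smul, hw]
    exact (Submodule.Quotient.mk_eq_zero _).mpr (Submodule.mem_span_singleton_self _)
  let ψ := Submodule.liftQ _ _ hker
  -- The shear (s, b) ↦ (s, b - sw) moves the generator to (pʸ, 0) and identifies the quotient with
  -- Λ/pʸ × B/(p^x₁ u).
  let φ := ((Submodule.factor hle).comp (LinearMap.fst Λ (Λ ⧸ maximalIdeal Λ ^ (x₀ + 1)) B)).prod
    (q.comp (LinearMap.snd Λ (Λ ⧸ maximalIdeal Λ ^ (x₀ + 1)) B)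
      - ψ.comp (LinearMap.fst Λ (Λ ⧸ maximalIdeal Λ ^ (x₀ + 1)) B))
  have hφ : ∀ (s : Λ) (b : B), φ (Submodule.Quotient.mk s, b)
      = (Submodule.Quotient.mk s, q (b - s • w)) := by
    intro s b
    simp only [map_sub, map_smul]
    rfl
  refine ((hasCount_cyclic y).prod hg).of_surjective φ ?_ ?_
  · rintro ⟨s, b⟩
    obtain ⟨s, rfl⟩ := Submodule.Quotient.mk_surjective _ s
    obtain ⟨b, rfl⟩ := Submodule.Quotient.mk_surjective _ b
    refine ⟨(Submodule.Quotient.mk s, b + s • w), ?_⟩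
    rw [hφ, add_sub_cancel_right]
    rfl
  · apply le_antisymm
    · rw [Submodule.span_singleton_le_iff_mem, LinearMap.mem_ker]
      have : ϖ ^ y • ((Submodule.Quotient.mk 1, w) : (Λ ⧸ maximalIdeal Λ ^ (x₀ + 1)) × B)
          = (Submodule.Quotient.mk (ϖ ^ y), ϖ ^ y • w) := by
        rw [Prod.smul_mk, ← Submodule.Quotient.mk_smul, smul_eq_mul, mul_one]
      rw [this, hφ, sub_self, map_zero, Prod.mk_eq_zero]
      exact ⟨(mk_maximalIdeal_pow_eq_zero hϖ).mpr ⟨1, by simp⟩, rfl⟩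
    · rintro ⟨s, b⟩ h
      obtain ⟨s, rfl⟩ := Submodule.Quotient.mk_surjective _ s
      rw [LinearMap.mem_ker, hφ, Prod.mk_eq_zero, mk_maximalIdeal_pow_eq_zero hϖ] at h
      obtain ⟨⟨t, rfl⟩, h⟩ := h
      obtain ⟨c, hc⟩ := Submodule.mem_span_singleton.mp ((Submodule.Quotient.mk_eq_zero _).mp h)
      rw [← hw] at hc
      -- From s = pʸt and b - sw = c p^(x₀+1) w one reads off b = (pʸt + c p^(x₀+1))w; the
      -- additional multiple of p^(x₀+1) vanishes in the first component.
      refine Submodule.mem_span_singleton.mpr ⟨t + c * ϖ ^ (x₀ + 1 - y), ?_⟩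
      have hpow : (t + c * ϖ ^ (x₀ + 1 - y)) * ϖ ^ y = ϖ ^ y * t + ϖ ^ (x₀ + 1) * c := by
        have : ϖ ^ (x₀ + 1) = ϖ ^ (x₀ + 1 - y) * ϖ ^ y := by
          rw [← pow_add]
          congr 1
          omega
        rw [this]
        ring
      rw [smul_smul, hpow, Prod.smul_mk, Prod.mk.injEq]
      constructor
      · rw [← Submodule.Quotient.mk_smul, smul_eq_mul, mul_one, Submodule.Quotient.mk_add,
          add_eq_left, mk_maximalIdeal_pow_eq_zero hϖ]
        exact ⟨c, rfl⟩
      · rw [add_smul, mul_comm (ϖ ^ (x₀ + 1)), mul_smul c, hc]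
        abel

theorem hasCount_quotient_span_zero_pair {M : Type*} [AddCommGroup M] [Module Λ M] {v : B}
    {f g : ℕ → ℕ} (hf : HasCount Λ M f) (hg : HasCount Λ (B ⧸ Submodule.span Λ {v}) g) :
    HasCount Λ ((M × B) ⧸ Submodule.span Λ {((0, v) : M × B)}) (f + g) := by
  refine (hf.prod hg).of_surjective (LinearMap.id.prodMap (Submodule.mkQ _)) ?_ ?_
  · exact Function.Surjective.prodMap Function.surjective_id (Submodule.mkQ_surjective _)
  · rw [LinearMap.ker_prodMap, Submodule.ker_mkQ, LinearMap.ker_id]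
    ext ⟨s, b⟩
    simp only [Submodule.mem_span_singleton, Submodule.mem_prod, Submodule.mem_bot, Prod.smul_mk,
      smul_zero, Prod.mk.injEq, exists_and_left, eq_comm]

/-- After a larger jump a cyclic summand of length `x 0 + 1` is added. It gives the new generator
its height `x 0`, dies after one further multiplication by p, and then leaves the old generator.
That w is divisible by p is what makes `socle` survive. -/
theorem IsHeightModel.cons_split (hϖ : Irreducible ϖ) {u w w' : B}
    (H : IsHeightModel ϖ m (fun i => x (i + 1)) B u) (hm : 0 < m → x 0 + 1 < x 1)
    (hw : ϖ ^ (x 0 + 1) • w = ϖ ^ x 1 • u) (hw' : w = ϖ • w') :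
    IsHeightModel ϖ (m + 1) x ((Λ ⧸ maximalIdeal Λ ^ (x 0 + 1)) × B)
      (Submodule.Quotient.mk 1, w) := by
  have hmerge : ∀ r, mergeCount (m + 1) x r = mergeCount m (fun i => x (i + 1)) r := by
    intro r
    rw [mergeCount_succ, if_neg, add_zero]
    rintro ⟨h, h1, -⟩
    have := hm h
    omega
  have hzero : ∀ s : Λ ⧸ maximalIdeal Λ ^ (x 0 + 1), ϖ ^ (x 0 + 1) • s = 0 :=
    pow_smul_quotient_eq_zero hϖ _
  have ha : ∀ k, ϖ ^ (k + 1) • ϖ ^ x 0 •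
      ((Submodule.Quotient.mk 1, w) : (Λ ⧸ maximalIdeal Λ ^ (x 0 + 1)) × B)
        = (0, ϖ ^ k • ϖ ^ x 1 • u) := by
    intro k
    rw [← hw, smul_smul, ← pow_add ϖ, show k + 1 + x 0 = k + (x 0 + 1) by omega, pow_add ϖ, mul_smul,
      Prod.smul_mk (ϖ ^ (x 0 + 1)), hzero, Prod.smul_mk, smul_zero]
  have htop : ∀ y ≤ x 0, ∃ g : ℕ → ℕ, HasCount Λ (((Λ ⧸ maximalIdeal Λ ^ (x 0 + 1)) × B) ⧸
      Submodule.span Λ {ϖ ^ y •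
        ((Submodule.Quotient.mk 1, w) : (Λ ⧸ maximalIdeal Λ ^ (x 0 + 1)) × B)}) g ∧
      ∀ r, g r + mergeCount (m + 1) x r
        = boxCount (m + 1) (fun i => if i = 0 then y else x i) 0 r := by
    intro y hy
    obtain ⟨g, hg, h⟩ := H.quot 0
    refine ⟨_, hasCount_quotient_span_pair hϖ hy hw (by rwa [pow_zero, one_smul] at hg), fun r => ?_⟩
    have := h r
    rw [hmerge, boxCount_succ_zero]
    simp only [Pi.add_apply, Nat.add_eq_zero_iff, one_ne_zero, and_false, if_false, if_true]
    omega
  refine ⟨(isFiniteLength_quotient_maximalIdeal_pow _).prod H.finiteLength, ?_, by simp, htop,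
    ?_, ?_, ?_, ?_⟩
  · obtain ⟨n, hn⟩ := H.torsion
    refine ⟨n + (x 0 + 1), fun b => Prod.ext ?_ ?_⟩
    · rw [pow_add ϖ, mul_smul, Prod.smul_fst, Prod.smul_fst, hzero, smul_zero, Prod.fst_zero]
    · rw [pow_add ϖ, mul_smul, Prod.smul_snd, hn, Prod.snd_zero]
  · rintro (_ | k)
    · obtain ⟨g, hg, h⟩ := htop (x 0) le_rfl
      refine ⟨g, by rwa [pow_zero, one_smul], fun r => (h r).trans ?_⟩
      congr 1
      ext i
      split_ifs with hi <;> simp [hi]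
    · obtain ⟨g, hg, h⟩ := H.quot k
      rw [ha]
      refine ⟨_, hasCount_quotient_span_zero_pair (hasCount_cyclic _) hg, fun r => ?_⟩
      have := h r
      rw [hmerge, boxCount_succ_succ]
      simp only [Pi.add_apply]
      omega
  · rintro h ⟨s, b⟩ hz ⟨⟨s', b'⟩, hb⟩
    rw [Prod.smul_mk, Prod.mk_eq_zero] at hz
    rw [Prod.smul_mk, Prod.mk.injEq] at hb
    obtain ⟨t, ht, b₁, hb₁⟩ := H.socle h b hz.2 ⟨b', hb.2⟩
    obtain ⟨c, rfl⟩ := Submodule.mem_span_singleton.mp ht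
    obtain ⟨s', rfl⟩ := Submodule.Quotient.mk_surjective _ s'
    have hmem : ∀ c : Λ, ((0, c • ϖ ^ x 1 • u) : (Λ ⧸ maximalIdeal Λ ^ (x 0 + 1)) × B) ∈
        Submodule.span Λ {ϖ ^ x 0 •
          ((Submodule.Quotient.mk 1, w) : (Λ ⧸ maximalIdeal Λ ^ (x 0 + 1)) × B)} := by
      intro c
      refine Submodule.mem_span_singleton.mpr ⟨c * ϖ ^ 1, ?_⟩
      rw [mul_smul, show 1 = 0 + 1 from rfl, ha, Prod.smul_mk, smul_zero, pow_zero, one_smul]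
    -- the first component is a multiple of `ϖ ^ x 0`
    have hs : ϖ • s = 0 := hz.1
    rw [hb.1, ← Submodule.Quotient.mk_smul, ← Submodule.Quotient.mk_smul,
      mk_maximalIdeal_pow_eq_zero hϖ] at hs
    obtain ⟨d, hd⟩ := hs
    have hd' : ϖ ^ h * s' = ϖ ^ x 0 * d := by
      apply mul_left_cancel₀ hϖ.ne_zero
      simp only [smul_eq_mul] at hd
      rw [hd]
      ring
    have hs' : s = Submodule.Quotient.mk (ϖ ^ x 0 * d) := by
      rw [hb.1, ← Submodule.Quotient.mk_smul, smul_eq_mul, hd']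
    -- The socle of the new summand has height exactly `x 0`. Below that level its height exceeds h
    -- already, above it s is zero. At the level itself, subtracting d times the new generator
    -- removes s, at the cost of a term dp^(x 0)w in B, which has height at least `x 0 + 1`.
    rcases lt_trichotomy h (x 0) with hh | hh | hh
    · refine ⟨_, hmem c, (Submodule.Quotient.mk (ϖ ^ (x 0 - (h + 1)) * d), b₁), ?_⟩
      rw [Prod.smul_mk, Prod.mk_sub_mk, sub_zero, Prod.mk.injEq]
      refine ⟨?_, hb₁⟩
      rw [hs', ← Submodule.Quotient.mk_smul, smul_eq_mul, ← mul_assoc, ← pow_add]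
      congr 3
      omega
    · refine ⟨_, Submodule.add_mem _ (hmem c)
        (Submodule.smul_mem _ d (Submodule.mem_span_singleton_self _)), (0, b₁ - d • w'), ?_⟩
      rw [Prod.smul_mk, Prod.smul_mk, Prod.smul_mk, Prod.mk_add_mk, Prod.mk_sub_mk, Prod.mk.injEq]
      constructor
      · rw [hs', ← Submodule.Quotient.mk_smul, ← Submodule.Quotient.mk_smul]
        simp [mul_comm]
      · rw [smul_sub, ← hb₁, hw', hh, pow_succ ϖ, mul_smul]
        change b - (c • ϖ ^ x 1 • u + d • ϖ ^ x 0 • ϖ • w')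
          = b - c • ϖ ^ x 1 • u - ϖ ^ x 0 • ϖ • d • w'
        module
    · refine ⟨_, hmem c, (0, b₁), ?_⟩
      rw [Prod.smul_mk, Prod.mk_sub_mk, sub_zero, Prod.mk.injEq]
      refine ⟨?_, hb₁⟩
      rw [hs', ← hd', smul_zero, mk_maximalIdeal_pow_eq_zero hϖ]
      refine ⟨ϖ ^ (h - (x 0 + 1)) * s', ?_⟩
      rw [← mul_assoc, ← pow_add]
      congr 2
      omega
  · rintro (_ | k) hk
    · exact ⟨_, by rw [pow_zero, one_smul]⟩
    · obtain ⟨b, hb⟩ := H.height k (by omega)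
      refine ⟨(0, b), ?_⟩
      rw [ha, Prod.smul_mk, smul_zero]
      exact congrArg _ hb
  · rintro (_ | k) hk ⟨b, hb⟩
    · have := congrArg Prod.fst hb
      rw [pow_zero, one_smul, Prod.smul_fst, Prod.smul_fst, hzero, ← Submodule.Quotient.mk_smul,
        mk_maximalIdeal_pow_eq_zero hϖ] at this
      obtain ⟨t, ht⟩ := this
      rw [smul_eq_mul, pow_succ, mul_assoc] at ht
      have := mul_left_cancel₀ (pow_ne_zero _ hϖ.ne_zero) ht
      exact hϖ.not_isUnit (IsUnit.of_mul_eq_one _ this.symm)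
    · rw [ha] at hb
      exact H.not_height k (by omega) ⟨b.2, congrArg Prod.snd hb⟩

theorem exists_isHeightModel (hϖ : Irreducible ϖ) (m : ℕ) (x : ℕ → ℕ)
    (hx : ∀ i, i + 1 < m → x i < x (i + 1)) :
    ∃ (B : Type u) (_ : AddCommGroup B) (_ : Module Λ B) (u : B), IsHeightModel ϖ m x B u := by
  induction m generalizing x with
  | zero => exact ⟨_, _, _, _, isHeightModel_zero ϖ x⟩
  | succ m ih =>
    obtain ⟨B, _, _, u, H⟩ := ih (fun i => x (i + 1)) fun i hi => hx (i + 1) (by omega)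
    rcases Nat.eq_zero_or_pos m with rfl | hm
    · have := H.zero rfl
      exact ⟨_, _, _, _, H.cons_split hϖ (w := 0) (w' := 0) (by simp) (Subsingleton.elim _ _)
        (Subsingleton.elim _ _)⟩
    · have h01 := hx 0 (by omega)
      rw [zero_add] at h01
      rcases eq_or_ne (x 1) (x 0 + 1) with h | h
      · exact ⟨_, _, _, _, H.cons_merge hm h⟩
      · refine ⟨_, _, _, _, H.cons_split hϖ (w := ϖ ^ (x 1 - (x 0 + 1)) • u)
          (w' := ϖ ^ (x 1 - (x 0 + 2)) • u) (fun _ => by omega) ?_ ?_⟩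
        · rw [smul_smul, ← pow_add]
          congr 2
          omega
        · rw [smul_smul, ← pow_succ']
          congr 2
          omega

end

/-! ### Heights as isomorphism invariants. -/

namespace ModEmbedding

variable {Λ : Type u} [CommRing Λ]

/-- All elements of `pᵏA` have height at least `h` in `B`. -/
def HeightGE (ϖ : Λ) (E : ModEmbedding Λ) (k h : ℕ) : Prop :=
  ∀ a ∈ E.A, ∃ b, ϖ ^ k • a = ϖ ^ h • b

theorem HeightGE.mono {ϖ : Λ} {E : ModEmbedding Λ} {k h h' : ℕ} (H : E.HeightGE ϖ k h)
    (hh : h' ≤ h) : E.HeightGE ϖ k h' := by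
  intro a ha
  obtain ⟨b, hb⟩ := H a ha
  refine ⟨ϖ ^ (h - h') • b, ?_⟩
  rw [hb, smul_smul, ← pow_add]
  congr 2
  omega

theorem HeightGE.of_iso {ϖ : Λ} {E F : ModEmbedding Λ} {k h : ℕ} (H : E.HeightGE ϖ k h)
    (hEF : E.Iso F) : F.HeightGE ϖ k h := by
  obtain ⟨φ, hφ⟩ := hEF
  intro a ha
  rw [← hφ] at ha
  obtain ⟨a, ha, rfl⟩ := ha
  obtain ⟨b, hb⟩ := H a ha
  refine ⟨φ b, ?_⟩
  change ϖ ^ k • φ a = _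
  rw [← map_smul, hb, map_smul]

theorem Iso.symm {E F : ModEmbedding Λ} (h : E.Iso F) : F.Iso E := by
  obtain ⟨φ, hφ⟩ := h
  refine ⟨φ.symm, ?_⟩
  rw [← hφ, ← Submodule.map_comp]
  simp

/-- The sequence of heights of the submodules `pᵏA`, for `k < m`. -/
def HasHeights (ϖ : Λ) (E : ModEmbedding Λ) (m : ℕ) (x : ℕ → ℕ) : Prop :=
  ∀ k < m, E.HeightGE ϖ k (x k) ∧ ¬ E.HeightGE ϖ k (x k + 1)

theorem HasHeights.not_iso {ϖ : Λ} {E F : ModEmbedding Λ} {m m' k : ℕ} {x x' : ℕ → ℕ}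
    (hE : E.HasHeights ϖ m x) (hF : F.HasHeights ϖ m' x') (hk : k < m) (hk' : k < m')
    (hx : x k ≠ x' k) : ¬ E.Iso F := by
  intro h
  rcases Nat.lt_or_gt_of_ne hx with hx | hx
  · exact (hE k hk).2 (((hF k hk').1.of_iso h.symm).mono hx)
  · exact (hF k hk').2 (((hE k hk).1.of_iso h).mono hx)

end ModEmbedding

/-! ### Indecomposability, poles and empty embeddings. -/

section

variable {Λ : Type u} [CommRing Λ] [IsDomain Λ] [IsDiscreteValuationRing Λ]

open IsLocalRing

theorem le_total_of_le_span_singleton {M : Type*} [AddCommGroup M] [Module Λ M] {v : M}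
    {F G : Submodule Λ M} (hF : F ≤ Submodule.span Λ {v}) (hG : G ≤ Submodule.span Λ {v}) :
    F ≤ G ∨ G ≤ F := by
  have key : ∀ {F G : Submodule Λ M}, F ≤ Submodule.span Λ {v} →
      F.comap (LinearMap.toSpanSingleton Λ M v) ≤ G.comap (LinearMap.toSpanSingleton Λ M v) →
      F ≤ G := by
    intro F G hF h z hz
    obtain ⟨c, rfl⟩ := Submodule.mem_span_singleton.mp (hF hz)
    exact h hz
  exact ((ValuationRing.iff_ideal_total.mp inferInstance).total
    (F.comap (LinearMap.toSpanSingleton Λ M v)) (G.comap (LinearMap.toSpanSingleton Λ M v))).imp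
    (key hF) (key hG)

theorem isIndecomposableModule_span_singleton {M : Type*} [AddCommGroup M] [Module Λ M] {v : M}
    (hv : v ≠ 0) : IsIndecomposableModule Λ (Submodule.span Λ {v}) := by
  refine ⟨Submodule.nontrivial_iff_ne_bot.mpr (by simpa using hv), fun F G h => ?_⟩
  have hle : F ≤ G ∨ G ≤ F := by
    have hinj := Submodule.map_le_map_iff_of_injective
      (Submodule.subtype_injective (Submodule.span Λ {v}))
    rw [← hinj F G, ← hinj G F]
    exact le_total_of_le_span_singleton (Submodule.map_subtype_le _ _)
      (Submodule.map_subtype_le _ _)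
  exact hle.imp (fun hFG => h.disjoint.eq_bot_of_le hFG)
    fun hGF => h.disjoint.symm.eq_bot_of_le hGF

variable {ϖ : Λ} {m : ℕ} {x : ℕ → ℕ} {B : Type u} [AddCommGroup B] [Module Λ B] {u : B}

/-- The embedding of the submodule generated by `pˣ⁽⁰⁾u`. -/
def IsHeightModel.embedding (H : IsHeightModel ϖ m x B u) : ModEmbedding Λ where
  B := B
  finiteLength := H.finiteLength
  A := Submodule.span Λ {ϖ ^ x 0 • u}

/-- A direct summand of `B` whose projection kills the submodule is zero. -/
theorem IsHeightModel.subsingleton_of_retract (H : IsHeightModel ϖ m x B u)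
    {C : Type*} [AddCommGroup C] [Module Λ C] (π : B →ₗ[Λ] C) (σ : C →ₗ[Λ] B)
    (hπσ : ∀ c, π (σ c) = c) (hπ : π (ϖ ^ x 0 • u) = 0) : Subsingleton C := by
  obtain ⟨n, hn⟩ := H.torsion
  have hC : ∀ c : C, ϖ ^ n • c = 0 := fun c => by
    rw [← hπσ c, ← map_smul, hn, map_zero]
  -- Projecting the `socle` property to C, where the correction from A disappears, gives socle
  -- elements of C arbitrary height; torsion then makes them zero.
  have hsocle : ∀ (h : ℕ) (c : C), ϖ • c = 0 → ∃ b, c = ϖ ^ h • b := by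
    intro h
    induction h with
    | zero => exact fun c _ => ⟨c, by simp⟩
    | succ h ih =>
      intro c hc
      obtain ⟨b, hb⟩ := ih c hc
      obtain ⟨t, ht, b', hb'⟩ := H.socle h (σ c) (by rw [← map_smul, hc, map_zero])
        ⟨σ b, by rw [← map_smul, ← hb]⟩
      obtain ⟨d, rfl⟩ := Submodule.mem_span_singleton.mp ht
      refine ⟨π b', ?_⟩
      rw [← map_smul, ← hb', map_sub, hπσ, map_smul, hπ, smul_zero, sub_zero]
  have hinj : ∀ c : C, ϖ • c = 0 → c = 0 := by
    intro c hc
    obtain ⟨b, rfl⟩ := hsocle n c hc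
    exact hC b
  have hpow : ∀ (k : ℕ) (c : C), ϖ ^ k • c = 0 → c = 0 := by
    intro k
    induction k with
    | zero => exact fun c hc => by simpa using hc
    | succ k ih =>
      intro c hc
      rw [pow_succ, mul_smul] at hc
      exact hinj c (ih _ hc)
  exact ⟨fun c d => (hpow n c (hC c)).trans (hpow n d (hC d)).symm⟩

theorem IsHeightModel.generator_ne_zero (H : IsHeightModel ϖ m x B u) (hm : 0 < m) :
    ϖ ^ x 0 • u ≠ 0 :=
  fun h => H.not_height 0 hm ⟨0, by rw [h, smul_zero, smul_zero]⟩

/-- A cyclic module over a valuation ring is uniserial, so in a decomposition one of the two parts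
of A lies in the other and is zero. The summand of B containing it is then zero by
`subsingleton_of_retract`. -/
theorem IsHeightModel.isPole (H : IsHeightModel ϖ m x B u) (hm : 0 < m) : H.embedding.IsPole := by
  refine ⟨isIndecomposableModule_span_singleton (H.generator_ne_zero hm), ?_, ?_⟩
  · intro h
    have : Subsingleton B := h
    exact H.generator_ne_zero hm (Subsingleton.elim _ _)
  · rintro F G ⟨φ, hφ⟩
    change B ≃ₗ[Λ] F.B × G.B at φ
    change (Submodule.span Λ {ϖ ^ x 0 • u}).map _ = F.A.prod G.A at hφ
    have hmem : φ (ϖ ^ x 0 • u) ∈ F.A.prod G.A := by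
      rw [← hφ]
      exact ⟨_, Submodule.mem_span_singleton_self _, rfl⟩
    rw [Submodule.map_span, Set.image_singleton] at hφ
    have h1 : F.A.prod ⊥ ≤ F.A.prod G.A := Submodule.prod_mono le_rfl bot_le
    have h2 : (⊥ : Submodule Λ F.B).prod G.A ≤ F.A.prod G.A := Submodule.prod_mono bot_le le_rfl
    rcases le_total_of_le_span_singleton (h1.trans hφ.ge) (h2.trans hφ.ge) with h | h
    · left
      refine H.subsingleton_of_retract ((LinearMap.fst Λ F.B G.B).comp φ.toLinearMap)
        (φ.symm.toLinearMap.comp (LinearMap.inl Λ F.B G.B)) (fun c => by simp) ?_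
      have : (((φ (ϖ ^ x 0 • u)).1, 0) : F.B × G.B) ∈ F.A.prod ⊥ := ⟨hmem.1, rfl⟩
      exact (h this).1
    · right
      refine H.subsingleton_of_retract ((LinearMap.snd Λ F.B G.B).comp φ.toLinearMap)
        (φ.symm.toLinearMap.comp (LinearMap.inr Λ F.B G.B)) (fun c => by simp) ?_
      have : ((0, (φ (ϖ ^ x 0 • u)).2) : F.B × G.B) ∈ (⊥ : Submodule Λ F.B).prod G.A :=
        ⟨rfl, hmem.2⟩
      exact (h this).2

theorem IsHeightModel.hasHeights (H : IsHeightModel ϖ m x B u) : H.embedding.HasHeights ϖ m x := by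
  intro k hk
  constructor
  · change ∀ a ∈ Submodule.span Λ {ϖ ^ x 0 • u}, ∃ b : B, ϖ ^ k • a = ϖ ^ x k • b
    intro a ha
    obtain ⟨c, rfl⟩ := Submodule.mem_span_singleton.mp ha
    obtain ⟨b, hb⟩ := H.height k hk
    exact ⟨c • b, by rw [smul_comm _ c, smul_comm _ c, ← hb]⟩
  · intro h
    change ∀ a ∈ Submodule.span Λ {ϖ ^ x 0 • u}, ∃ b : B, ϖ ^ k • a = ϖ ^ (x k + 1) • b at h
    exact H.not_height k hk (h _ (Submodule.mem_span_singleton_self _))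

open Pointwise in
theorem IsHeightModel.hasCounts (hϖ : Irreducible ϖ) (H : IsHeightModel ϖ m x B u) :
    ∃ F : ℕ → ℕ → ℕ, H.embedding.HasCounts F ∧
      ∀ k r, F k r + mergeCount m x r = boxCount m x k r := by
  choose F hF hF' using H.quot
  refine ⟨F, fun k => (hF k).of_equiv (Submodule.quotEquivOfEq _ _ ?_), hF'⟩
  rw [hϖ.maximalIdeal_eq, Ideal.span_singleton_pow, Submodule.ideal_span_singleton_smul]
  change ϖ ^ k • Submodule.span Λ {ϖ ^ x 0 • u} = _
  rw [Submodule.smul_span, Set.smul_set_singleton]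

/-- Every strictly increasing finite sequence is the height sequence of a pole. -/
theorem exists_pole_of_heights (hϖ : Irreducible ϖ) {m : ℕ} (hm : 0 < m) (x : ℕ → ℕ)
    (hx : ∀ i, i + 1 < m → x i < x (i + 1)) :
    ∃ P : ModEmbedding Λ, P.IsPole ∧ P.HasHeights ϖ m x ∧ ∃ F : ℕ → ℕ → ℕ, P.HasCounts F ∧
      ∀ k r, F k r + mergeCount m x r = boxCount m x k r := by
  obtain ⟨B, _, _, u, H⟩ := exists_isHeightModel hϖ m x hx
  exact ⟨H.embedding, H.isPole hm, H.hasHeights, H.hasCounts hϖ⟩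

/-- Every finite family of lengths is the type of an empty embedding. -/
theorem exists_isEmptyEmb {t : ℕ} (c : Fin t → ℕ) :
    ∃ E : ModEmbedding Λ, E.IsEmptyEmb ∧
      E.HasCounts fun _ r => ∑ j, if r < c j then 1 else 0 := by
  have h : ∀ j, ModEmbedding.HasCounts
      (⟨Λ ⧸ maximalIdeal Λ ^ c j, isFiniteLength_quotient_maximalIdeal_pow _, ⊥⟩ : ModEmbedding Λ)
      fun _ r => if r < c j then 1 else 0 := by
    intro j k
    exact (hasCount_cyclic (c j)).of_equiv (Submodule.quotEquivOfEqBot _ (Submodule.smul_bot _))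
  refine ⟨_, ?_, ModEmbedding.HasCounts.sum h⟩
  rw [ModEmbedding.IsEmptyEmb, eq_bot_iff]
  intro z hz
  exact funext fun j => hz j trivial

end

/-! ### Entries counted by rows. -/

theorem singleColumn_rowLen (h r : ℕ) : (singleColumn h).rowLen r = if r < h then 1 else 0 := by
  have key : ∀ j, j < (singleColumn h).rowLen r ↔ r < h ∧ j = 0 := by
    intro j
    rw [← YoungDiagram.mem_iff_lt_rowLen, ← YoungDiagram.mem_cells]
    simp only [singleColumn, Finset.mem_product, Finset.mem_range, Finset.mem_singleton]
  have h0 := key 0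
  have h1 := key 1
  split_ifs with hr <;> simp [hr] at h0 h1 <;> omega

theorem YoungDiagram.card_filter_fst_lt (μ : YoungDiagram) (r : ℕ) :
    (μ.cells.filter fun b => b.1 < r).card = ∑ t ∈ Finset.range r, μ.rowLen t := by
  rw [Finset.card_eq_sum_card_fiberwise (f := Prod.fst) (t := Finset.range r)]
  · refine Finset.sum_congr rfl fun t ht => ?_
    rw [YoungDiagram.rowLen_eq_card, YoungDiagram.row, Finset.filter_filter]
    congr 1
    ext b
    rw [Finset.mem_range] at ht
    simp only [Finset.mem_filter, and_congr_right_iff]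
    intro _
    exact ⟨fun h => h.2, fun h => ⟨h ▸ ht, h⟩⟩
  · intro b hb
    simp only [Finset.coe_filter, Set.mem_ofPred_eq] at hb
    simpa using hb.2

namespace Tableau

/-- The lattice permutation property, read by rows: up to any row there are at most as many
entries `e + 1` as there are entries `e` in the rows strictly above. -/
theorem IsLR.card_filter_row_le {Γ : Tableau} (h : Γ.IsLR) {e : ℕ} (he : 1 ≤ e) (r : ℕ) :
    ((Γ.boxes (e + 1)).filter fun b => b.1 < r + 1).card
      ≤ ((Γ.boxes e).filter fun b => b.1 < r).card := by
  rcases ((Γ.boxes (e + 1)).filter fun b => b.1 < r + 1).eq_empty_or_nonempty with h0 | h0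
  · rw [h0]
    simp
  -- The lattice condition is applied at the leftmost column c that contains an entry e + 1 in one
  -- of these rows.
  obtain ⟨⟨r₀, c⟩, hc, hmin⟩ := Finset.exists_min_image _ Prod.snd h0
  calc _ ≤ Γ.countRight (e + 1) c := by
        refine Finset.card_le_card fun b hb => ?_
        exact Finset.mem_filter.mpr ⟨(Finset.mem_filter.mp hb).1, hmin b hb⟩
    _ ≤ Γ.countRight e c := h.lattice e he c
    _ ≤ _ := by
        refine Finset.card_le_card ?_
        rintro ⟨t, j⟩ hb
        rw [Finset.mem_filter] at hb hc ⊢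
        refine ⟨hb.1, ?_⟩
        rw [boxes, Finset.mem_sdiff] at hb hc
        by_contra hlt
        -- An entry e in row r or below, and in column c or to the right, would force the box (r₀,
        -- c) to have an entry at most e.
        have hrt : r₀ ≤ t := by
          have := hc.2
          simp only at this hlt
          omega
        refine hc.1.2 ((Γ.diag e).isLowerSet ?_ hb.1.1)
        exact Prod.mk_le_mk.mpr ⟨hrt, hb.2⟩

theorem card_boxes_filter_add (Γ : Tableau) (i r : ℕ) :
    ((Γ.boxes (i + 1)).filter fun b => b.1 < r).card
      + ∑ t ∈ Finset.range r, (Γ.diag i).rowLen t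
        = ∑ t ∈ Finset.range r, (Γ.diag (i + 1)).rowLen t := by
  rw [← YoungDiagram.card_filter_fst_lt, ← YoungDiagram.card_filter_fst_lt, boxes,
    Nat.add_sub_cancel, ← Finset.card_sdiff_add_card_eq_card (s := (Γ.diag i).cells.filter fun b => b.1 < r)
      (t := (Γ.diag (i + 1)).cells.filter fun b => b.1 < r)]
  · congr 2
    ext b
    simp only [Finset.mem_filter, Finset.mem_sdiff]
    tauto
  · exact Finset.filter_subset_filter _ (YoungDiagram.cells_subset_iff.mpr (Γ.mono (Nat.le_succ i)))

end Tableau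

/-! ### Matching columns and forming chains. -/

section Columns

variable {ι : Type} [Fintype ι]

/-- The tableau `Γ` is the union of the columns with the entries `a c + 1, …, b c` and heights
`n c`. -/
def Tableau.HasColumns (Γ : Tableau) (a b n : ι → ℕ) : Prop :=
  ∀ k r, (Γ.diag k).rowLen r = ∑ c, if r < columnHeight (a c + 1) (b c) (n c) k then 1 else 0

variable {Γ : Tableau} {a b n : ι → ℕ}

theorem sum_range_ite_lt (r h : ℕ) : (∑ t ∈ Finset.range r, if t < h then 1 else 0) = min r h := by
  induction r with
  | zero => simp
  | succ r ih =>
    rw [Finset.sum_range_succ, ih]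
    split_ifs <;> omega

/-- The entry `i + 1` of a column of height `n` with the entries `a + 1, …, b` is in the row
`n + i - b`. -/
theorem Tableau.HasColumns.card_boxes_filter (h : Γ.HasColumns a b n) (hab : ∀ c, a c ≤ b c)
    (hn : ∀ c, b c ≤ n c + a c) (i r : ℕ) :
    ((Γ.boxes (i + 1)).filter fun b => b.1 < r).card
      = (Finset.univ.filter fun c => (a c ≤ i ∧ i < b c) ∧ n c + i - b c < r).card := by
  have key := Γ.card_boxes_filter_add i r
  have hsum : ∀ k, ∑ t ∈ Finset.range r, (Γ.diag k).rowLen t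
      = ∑ c, min r (columnHeight (a c + 1) (b c) (n c) k) := by
    intro k
    simp only [h k]
    rw [Finset.sum_comm]
    exact Finset.sum_congr rfl fun c _ => sum_range_ite_lt _ _
  rw [hsum, hsum] at key
  have hc : ∑ c, min r (columnHeight (a c + 1) (b c) (n c) (i + 1))
      = (Finset.univ.filter fun c => (a c ≤ i ∧ i < b c) ∧ n c + i - b c < r).card
        + ∑ c, min r (columnHeight (a c + 1) (b c) (n c) i) := by
    rw [Finset.card_filter, ← Finset.sum_add_distrib]
    refine Finset.sum_congr rfl fun c _ => ?_
    have := hab c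
    have := hn c
    unfold columnHeight
    split_ifs <;> omega
  omega

variable [DecidableEq ι]

/-- The columns which start with the entry `i + 2` can be put, injectively, behind columns which
end with the entry `i + 1`. -/
theorem Tableau.HasColumns.exists_matching (h : Γ.HasColumns a b n) (hΓ : Γ.IsLR)
    (hab : ∀ c, a c ≤ b c) (hn : ∀ c, b c ≤ n c + a c) (i : ℕ) :
    ∃ g : ι → ι, (∀ c, a c = i + 1 → i + 1 < b c →
      a (g c) ≤ i ∧ b (g c) = i + 1 ∧ n (g c) + i - b (g c) < n c + (i + 1) - b c) ∧
      Set.InjOn g {c | a c = i + 1 ∧ i + 1 < b c} := by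
  have hcard : ∀ r, (Finset.univ.filter fun c =>
      (a c = i + 1 ∧ i + 1 < b c) ∧ n c + (i + 1) - b c ≤ r).card
      ≤ (Finset.univ.filter fun c => (a c ≤ i ∧ b c = i + 1) ∧ n c + i - b c < r).card := by
    intro r
    have h1 := hΓ.card_filter_row_le (e := i + 1) (by omega) r
    rw [h.card_boxes_filter hab hn, h.card_boxes_filter hab hn] at h1
    -- Columns containing both i + 1 and i + 2 contribute equally to both sides, since the two boxes
    -- lie in consecutive rows; they are cancelled.
    have h2 : (Finset.univ.filter fun c =>
          (a c ≤ i + 1 ∧ i + 1 < b c) ∧ n c + (i + 1) - b c < r + 1).card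
        = (Finset.univ.filter fun c => (a c = i + 1 ∧ i + 1 < b c) ∧ n c + (i + 1) - b c ≤ r).card
          + (Finset.univ.filter fun c => (a c ≤ i ∧ i + 1 < b c) ∧ n c + i - b c < r).card := by
      simp only [Finset.card_filter, ← Finset.sum_add_distrib]
      refine Finset.sum_congr rfl fun c _ => ?_
      have := hab c
      have := hn c
      split_ifs <;> omega
    have h3 : (Finset.univ.filter fun c => (a c ≤ i ∧ i < b c) ∧ n c + i - b c < r).card
        = (Finset.univ.filter fun c => (a c ≤ i ∧ b c = i + 1) ∧ n c + i - b c < r).card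
          + (Finset.univ.filter fun c => (a c ≤ i ∧ i + 1 < b c) ∧ n c + i - b c < r).card := by
      simp only [Finset.card_filter, ← Finset.sum_add_distrib]
      refine Finset.sum_congr rfl fun c _ => ?_
      split_ifs <;> omega
    omega
  obtain ⟨g, hg, hg'⟩ := (Finset.all_card_le_biUnion_card_iff_exists_injective
    (fun c : {c // a c = i + 1 ∧ i + 1 < b c} => Finset.univ.filter fun d =>
      (a d ≤ i ∧ b d = i + 1) ∧ n d + i - b d < n c + (i + 1) - b c)).mp (by
    intro s
    rcases s.eq_empty_or_nonempty with rfl | hs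
    · simp
    -- The sets of admissible partners are nested, so Hall's condition only has to be checked for
    -- the column of s with the lowest starting box.
    obtain ⟨c₀, hc₀, hmax⟩ := Finset.exists_max_image s
      (fun c => n c + (i + 1) - b c) hs
    calc s.card = (s.map (Function.Embedding.subtype _)).card := (Finset.card_map _).symm
      _ ≤ _ := Finset.card_le_card (fun c hc => by
        obtain ⟨c, hcs, rfl⟩ := Finset.mem_map.mp hc
        exact Finset.mem_filter.mpr ⟨Finset.mem_univ _, c.2, hmax c hcs⟩)
      _ ≤ _ := hcard (n c₀ + (i + 1) - b c₀)
      _ ≤ _ := Finset.card_le_card (Finset.subset_biUnion_of_mem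
        (fun c : {c // a c = i + 1 ∧ i + 1 < b c} => Finset.univ.filter fun d =>
          (a d ≤ i ∧ b d = i + 1) ∧ n d + i - b d < n c + (i + 1) - b c) hc₀))
  refine ⟨fun c => if hc : a c = i + 1 ∧ i + 1 < b c then g ⟨c, hc⟩ else c, ?_, ?_⟩
  · intro c h1 h2
    have := (Finset.mem_filter.mp (hg' ⟨c, h1, h2⟩)).2
    simp only [dif_pos (show a c = i + 1 ∧ i + 1 < b c from ⟨h1, h2⟩)]
    exact ⟨this.1.1, this.1.2, this.2⟩
  · intro c hc d hd hcd
    simp only [dif_pos (show _ ∧ _ from hc), dif_pos (show _ ∧ _ from hd)] at hcd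
    exact congrArg Subtype.val (hg hcd)

/-- Two families of columns which differ by an increasing box move: the columns `X` and `Y` have
equally many entries, those of `X` are smaller, and the heights are exchanged. -/
structure ColumnMove (a b n₁ n₂ : ι → ℕ) (X Y : ι) : Prop where
  le : ∀ c, a c ≤ b c
  le₁ : ∀ c, b c ≤ n₁ c + a c
  le₂ : ∀ c, b c ≤ n₂ c + a c
  nonempty : a X < b X
  start_lt : a X < a Y
  length_eq : b Y + a X = b X + a Y
  height_lt : n₁ Y < n₁ X
  height_X : n₂ X = n₁ Y
  height_Y : n₂ Y = n₁ X
  height_eq : ∀ c, c ≠ X → c ≠ Y → n₂ c = n₁ c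

variable {n₁ n₂ : ι → ℕ} {X Y : ι} {Γ' : Tableau}

/-- X is lower in Γ and Y is lower in Γ'. If X starts with i + 2 or Y ends with i + 1, the
constraints of Γ' are the stronger ones; otherwise those of Γ are. The inequalities between the
entries of X and Y exclude conflicting roles at the same i. -/
theorem ColumnMove.exists_matching (H : ColumnMove a b n₁ n₂ X Y) (h₁ : Γ.HasColumns a b n₁)
    (h₂ : Γ'.HasColumns a b n₂) (hΓ : Γ.IsLR) (hΓ' : Γ'.IsLR) (i : ℕ) :
    ∃ g : ι → ι, (∀ c, a c = i + 1 → i + 1 < b c →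
      a (g c) ≤ i ∧ b (g c) = i + 1 ∧ n₁ (g c) + i - b (g c) < n₁ c + (i + 1) - b c ∧
        n₂ (g c) + i - b (g c) < n₂ c + (i + 1) - b c) ∧
      Set.InjOn g {c | a c = i + 1 ∧ i + 1 < b c} := by
  have hne := H.nonempty
  have hlt := H.start_lt
  have hlen := H.length_eq
  have hh := H.height_lt
  have hX := H.height_X
  have hY := H.height_Y
  have hle : ∀ c, c ≠ Y → n₂ c ≤ n₁ c := by
    intro c hc
    rcases eq_or_ne c X with rfl | hcX
    · omega
    · exact (H.height_eq c hcX hc).le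
  have hge : ∀ c, c ≠ X → n₁ c ≤ n₂ c := by
    intro c hc
    rcases eq_or_ne c Y with rfl | hcY
    · omega
    · exact (H.height_eq c hc hcY).ge
  by_cases hi : a X = i + 1 ∨ b Y = i + 1
  · obtain ⟨g, hg, hinj⟩ := h₂.exists_matching hΓ' H.le H.le₂ i
    refine ⟨g, fun c hc hc' => ?_, hinj⟩
    obtain ⟨h3, h4, h5⟩ := hg c hc hc'
    refine ⟨h3, h4, ?_, h5⟩
    have h6 := hle c (by rintro rfl; omega)
    have h7 := hge (g c) (by intro h; rw [h] at h3 h4; omega)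
    omega
  · obtain ⟨g, hg, hinj⟩ := h₁.exists_matching hΓ H.le H.le₁ i
    refine ⟨g, fun c hc hc' => ?_, hinj⟩
    obtain ⟨h3, h4, h5⟩ := hg c hc hc'
    refine ⟨h3, h4, h5, ?_⟩
    have h6 := hge c (by rintro rfl; omega)
    have h7 := hle (g c) (by intro h; rw [h] at h3 h4; omega)
    omega

/-- `π` sends the column of an entry i + 2 to the column of its predecessor in the chain: the same
column if possible, its match otherwise. These cases do not collide, because matches end with i + 1
and fixed columns do not. The extension to a permutation makes the chains disjoint and exhaustive.
-/
theorem ColumnMove.exists_perm (H : ColumnMove a b n₁ n₂ X Y) (h₁ : Γ.HasColumns a b n₁)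
    (h₂ : Γ'.HasColumns a b n₂) (hΓ : Γ.IsLR) (hΓ' : Γ'.IsLR) (i : ℕ) :
    ∃ π : Equiv.Perm ι, ∀ c, a c ≤ i + 1 → i + 1 < b c →
      (a (π c) ≤ i ∧ i < b (π c)) ∧ n₁ (π c) + i - b (π c) < n₁ c + (i + 1) - b c ∧
        n₂ (π c) + i - b (π c) < n₂ c + (i + 1) - b c ∧ (a c ≤ i → π c = c) := by
  obtain ⟨g, hg, hinj⟩ := H.exists_matching h₁ h₂ hΓ hΓ' i
  obtain ⟨π, hπ⟩ := Finset.exists_equiv_extend_of_card_eq (α := ι) (β := ι) (t := Finset.univ)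
    (by simp) (s := Finset.univ.filter fun c => a c ≤ i + 1 ∧ i + 1 < b c)
    (f := fun c => if a c ≤ i then c else g c) (Finset.subset_univ _) (by
      intro c hc d hd hcd
      simp only [Finset.coe_filter, Finset.mem_univ, true_and, Set.mem_ofPred_eq] at hc hd
      simp only at hcd
      split_ifs at hcd with h3 h4 h4
      · exact hcd
      · have := hg d (by omega) hd.2
        rw [← hcd] at this
        omega
      · have := hg c (by omega) hc.2
        rw [hcd] at this
        omega
      · exact hinj ⟨by omega, hc.2⟩ ⟨by omega, hd.2⟩ hcd)
  refine ⟨π.trans (Equiv.subtypeUnivEquiv Finset.mem_univ), fun c hc hc' => ?_⟩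
  have h3 : π.trans (Equiv.subtypeUnivEquiv Finset.mem_univ) c = if a c ≤ i then c else g c :=
    hπ c (by simp [hc, hc'])
  rw [h3]
  have := H.le₁ c
  have := H.le₂ c
  split_ifs with h4
  · refine ⟨⟨h4, by omega⟩, by omega, by omega, fun _ => rfl⟩
  · obtain ⟨h5, h6, h7, h8⟩ := hg c (by omega) hc'
    exact ⟨⟨h5, by omega⟩, h7, h8, fun h => absurd h h4⟩

/-- The chains: the box with the entry `i + 1` in the chain `κ` belongs to the column `ψ i κ`, for
`i < m κ`. -/
structure IsChainDecomposition (a b n₁ n₂ : ι → ℕ) (ψ : ℕ → Equiv.Perm ι) (m : ι → ℕ) : Prop where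
  lt_iff : ∀ κ i, i < m κ ↔ a (ψ i κ) ≤ i ∧ i < b (ψ i κ)
  row₁ : ∀ κ i, i + 1 < m κ →
    n₁ (ψ i κ) + i - b (ψ i κ) < n₁ (ψ (i + 1) κ) + (i + 1) - b (ψ (i + 1) κ)
  row₂ : ∀ κ i, i + 1 < m κ →
    n₂ (ψ i κ) + i - b (ψ i κ) < n₂ (ψ (i + 1) κ) + (i + 1) - b (ψ (i + 1) κ)
  eq : ∀ κ i, i + 1 < m κ → a (ψ (i + 1) κ) ≤ i → ψ i κ = ψ (i + 1) κ

theorem ColumnMove.exists_isChainDecomposition (H : ColumnMove a b n₁ n₂ X Y)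
    (h₁ : Γ.HasColumns a b n₁) (h₂ : Γ'.HasColumns a b n₂) (hΓ : Γ.IsLR) (hΓ' : Γ'.IsLR) :
    ∃ (ψ : ℕ → Equiv.Perm ι) (m : ι → ℕ), IsChainDecomposition a b n₁ n₂ ψ m := by
  choose π hπ using H.exists_perm h₁ h₂ hΓ hΓ'
  let ψ : ℕ → Equiv.Perm ι := fun i => Nat.rec 1 (fun i σ => σ.trans (π i).symm) i
  have hψ : ∀ i κ, π i (ψ (i + 1) κ) = ψ i κ := fun i κ => (π i).apply_symm_apply _
  have hsucc : ∀ κ i, a (ψ (i + 1) κ) ≤ i + 1 ∧ i + 1 < b (ψ (i + 1) κ) →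
      a (ψ i κ) ≤ i ∧ i < b (ψ i κ) := by
    intro κ i h
    rw [← hψ]
    exact (hπ i _ h.1 h.2).1
  have hm : ∀ κ, ∃ m, ∀ i, i < m ↔ a (ψ i κ) ≤ i ∧ i < b (ψ i κ) := by
    intro κ
    -- No column has an entry larger than the supremum of `b`, so every chain stops. By `hsucc` it
    -- cannot resume, so its boxes form an initial segment.
    have hex : ∃ i, ¬ (a (ψ i κ) ≤ i ∧ i < b (ψ i κ)) := by
      refine ⟨Finset.univ.sup b, fun h => ?_⟩
      have := Finset.le_sup (f := b) (Finset.mem_univ (ψ (Finset.univ.sup b) κ))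
      omega
    classical
    refine ⟨Nat.find hex, fun i => ⟨fun hi => not_not.mp (Nat.find_min hex hi), fun hi => ?_⟩⟩
    by_contra hlt
    have hanti : ∀ j, ¬ (a (ψ (Nat.find hex + j) κ) ≤ Nat.find hex + j ∧
        Nat.find hex + j < b (ψ (Nat.find hex + j) κ)) := by
      intro j
      induction j with
      | zero => exact Nat.find_spec hex
      | succ j ih => exact fun h => ih (hsucc κ _ h)
    refine hanti (i - Nat.find hex) ?_
    rwa [Nat.add_sub_cancel' (not_lt.mp hlt)]
  choose m hm using hm
  refine ⟨ψ, m, hm, ?_, ?_, ?_⟩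
  · intro κ i hi
    obtain ⟨h3, h4⟩ := (hm κ (i + 1)).mp hi
    have := (hπ i _ h3 h4).2.1
    rwa [hψ] at this
  · intro κ i hi
    obtain ⟨h3, h4⟩ := (hm κ (i + 1)).mp hi
    have := (hπ i _ h3 h4).2.2.1
    rwa [hψ] at this
  · intro κ i hi h
    obtain ⟨h3, h4⟩ := (hm κ (i + 1)).mp hi
    have := (hπ i _ h3 h4).2.2.2 h
    rwa [hψ] at this

end Columns

/-! ### Counting boxes by columns and by chains. -/

theorem sum_range_ite_window {N a l : ℕ} (h : a + l ≤ N) (Q : ℕ → Prop) [DecidablePred Q] :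
    (∑ i ∈ Finset.range N, if (a ≤ i ∧ i < a + l) ∧ Q i then 1 else 0)
      = ∑ j ∈ Finset.range l, if Q (a + j) then 1 else 0 := by
  have hN : Finset.range l = Finset.range (a + l - a) := by rw [Nat.add_sub_cancel_left]
  rw [hN, ← Finset.sum_Ico_eq_sum_range (fun i => if Q i then 1 else 0)]
  have : Finset.Ico a (a + l) = (Finset.range N).filter fun i => a ≤ i ∧ i < a + l := by
    ext i
    simp only [Finset.mem_Ico, Finset.mem_filter, Finset.mem_range]
    omega
  rw [this, Finset.sum_filter]
  exact Finset.sum_congr rfl fun i _ => ite_and _ _ _ _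

/-- A column of l entries under s empty boxes equals its l one-box columns minus the l - 1 columns
lost by gluing. The last term corrects the case without entries, where the column itself remains. -/
theorem sum_boxes_of_column (s l q r : ℕ) :
    (if r < s + min q l then 1 else 0) + (∑ j ∈ Finset.range (l - 1), if r < s + j + 1 then 1 else 0)
      = (∑ j ∈ Finset.range l, if r < s + j + (if j < q then 1 else 0) then 1 else 0)
        + if l = 0 ∧ r < s then 1 else 0 := by
  induction l with
  | zero => simp
  | succ l ih =>
    rcases Nat.eq_zero_or_pos l with rfl | hl
    · have h : s + min q 1 = s + if 0 < q then 1 else 0 := by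
        split_ifs <;> omega
      simp only [zero_add, Nat.sub_self, Finset.range_zero, Finset.sum_empty, Finset.sum_range_one,
        add_zero, h, one_ne_zero, false_and, if_false]
    · rw [Finset.sum_range_succ, Nat.add_sub_cancel]
      obtain ⟨l, rfl⟩ := Nat.exists_eq_succ_of_ne_zero hl.ne'
      rw [Nat.succ_eq_add_one, Finset.sum_range_succ]
      rw [Nat.succ_eq_add_one, Nat.add_sub_cancel] at ih
      rw [if_neg (by omega : ¬ (l + 1 = 0 ∧ r < s))] at ih
      rw [if_neg (by omega : ¬ (l + 1 + 1 = 0 ∧ r < s)), add_zero]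
      rw [add_zero] at ih
      rw [← ih]
      generalize ∑ j ∈ Finset.range l, (if r < s + j + 1 then 1 else 0) = A
      split_ifs <;> omega

/-- A column with entries compared with the one-box columns of its boxes. -/
theorem columnHeight_count {a b n N : ℕ} (hab : a ≤ b) (hn : b ≤ n + a) (hN : b ≤ N) (k r : ℕ) :
    (if r < columnHeight (a + 1) b n k then 1 else 0)
      + (∑ i ∈ Finset.range N, if (a ≤ i ∧ i + 1 < b) ∧ r < n + i - b + 1 then 1 else 0)
      = (∑ i ∈ Finset.range N,
          if (a ≤ i ∧ i < b) ∧ r < n + i - b + (if i < k then 1 else 0) then 1 else 0)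
        + if a = b ∧ r < n then 1 else 0 := by
  obtain ⟨l, rfl⟩ := Nat.exists_eq_add_of_le hab
  obtain ⟨s, rfl⟩ : ∃ s, n = s + l := ⟨n - l, by omega⟩
  have h1 : columnHeight (a + 1) (a + l) (s + l) k = s + min (k - a) l := by
    unfold columnHeight
    split_ifs <;> omega
  have h2 : ∀ i, ((a ≤ i ∧ i + 1 < a + l) ∧ r < s + l + i - (a + l) + 1) ↔
      ((a ≤ i ∧ i < a + (l - 1)) ∧ r < s + l + i - (a + l) + 1) := by
    intro i
    omega
  simp only [h1, h2]
  rw [sum_range_ite_window (by omega), sum_range_ite_window (by omega)]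
  have h3 : ∀ j, s + l + (a + j) - (a + l) = s + j := fun j => by omega
  have h4 : ∀ j, (a + j < k) ↔ j < k - a := fun j => by omega
  have h5 : (a = a + l ∧ r < s + l) ↔ (l = 0 ∧ r < s) := by omega
  simp only [h3, h4, h5]
  exact sum_boxes_of_column s l (k - a) r

section Chains

variable {ι : Type} {a b n n₁ n₂ : ι → ℕ} {ψ : ℕ → Equiv.Perm ι} {m : ι → ℕ}
  {Γ : Tableau}

/-- The rows of the boxes in the chain `κ`. -/
def chainRow (b n : ι → ℕ) (ψ : ℕ → Equiv.Perm ι) (m : ι → ℕ) (κ : ι) (i : ℕ) : ℕ :=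
  if i < m κ then n (ψ i κ) + i - b (ψ i κ) else 0

theorem chainRow_of_lt {κ : ι} {i : ℕ} (h : i < m κ) :
    chainRow b n ψ m κ i = n (ψ i κ) + i - b (ψ i κ) := if_pos h

variable [Fintype ι]

theorem exists_fin_count {J K : Type*} [Fintype J] [Fintype K] (c : J → ℕ) (d : K → ℕ) :
    ∃ (t : ℕ) (z : Fin t → ℕ), ∀ r, (∑ j, if r < c j then 1 else 0)
      + (∑ j, if r < d j then 1 else 0) = ∑ j, if r < z j then 1 else 0 := by
  refine ⟨Fintype.card (J ⊕ K), fun j => Sum.elim c d ((Fintype.equivFin (J ⊕ K)).symm j),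
    fun r => ?_⟩
  rw [Equiv.sum_comp (Fintype.equivFin (J ⊕ K)).symm fun j => if r < Sum.elim c d j then 1 else 0,
    Fintype.sum_sum_type]
  rfl

theorem sum_boxes_eq_sum_chains {N : ℕ} (hN : ∀ c, b c ≤ N)
    (hm : ∀ κ i, i < m κ ↔ a (ψ i κ) ≤ i ∧ i < b (ψ i κ)) (Q : ι → ℕ → Prop)
    [∀ c, DecidablePred (Q c)] :
    (∑ c, ∑ i ∈ Finset.range N, if (a c ≤ i ∧ i < b c) ∧ Q c i then 1 else 0)
      = ∑ κ, ∑ i ∈ Finset.range (m κ), if Q (ψ i κ) i then 1 else 0 := by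
  have hmN : ∀ κ, 0 + m κ ≤ N := by
    intro κ
    by_contra h
    have := (hm κ N).mp (by omega)
    have := hN (ψ N κ)
    omega
  rw [Finset.sum_comm]
  have h1 : ∀ i, (∑ c, if (a c ≤ i ∧ i < b c) ∧ Q c i then 1 else 0)
      = ∑ κ, if (0 ≤ i ∧ i < 0 + m κ) ∧ Q (ψ i κ) i then 1 else 0 := by
    intro i
    rw [← Equiv.sum_comp (ψ i)]
    refine Finset.sum_congr rfl fun κ _ => ?_
    simp only [zero_add, Nat.zero_le, true_and, hm]
  simp only [h1]
  rw [Finset.sum_comm]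
  refine Finset.sum_congr rfl fun κ _ => ?_
  rw [sum_range_ite_window (hmN κ)]
  simp only [zero_add]

/-- Indexing by the lower of two adjacent boxes in a column works because its predecessor in the
chain lies in the same column. -/
theorem sum_inner_boxes_eq_sum_chains {N : ℕ} (hN : ∀ c, b c ≤ N)
    (hm : ∀ κ i, i < m κ ↔ a (ψ i κ) ≤ i ∧ i < b (ψ i κ)) (Q : ι → ℕ → Prop)
    [∀ c, DecidablePred (Q c)] :
    (∑ c, ∑ i ∈ Finset.range N, if (a c ≤ i ∧ i + 1 < b c) ∧ Q c i then 1 else 0)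
      = ∑ κ, ∑ i ∈ Finset.range (m κ),
        if (i + 1 < m κ ∧ a (ψ (i + 1) κ) ≤ i) ∧ Q (ψ (i + 1) κ) i then 1 else 0 := by
  have hmN : ∀ κ, 0 + m κ ≤ N := by
    intro κ
    by_contra h
    have := (hm κ N).mp (by omega)
    have := hN (ψ N κ)
    omega
  rw [Finset.sum_comm]
  have h1 : ∀ i, (∑ c, if (a c ≤ i ∧ i + 1 < b c) ∧ Q c i then 1 else 0)
      = ∑ κ, if (0 ≤ i ∧ i < 0 + m κ) ∧
        ((i + 1 < m κ ∧ a (ψ (i + 1) κ) ≤ i) ∧ Q (ψ (i + 1) κ) i) then 1 else 0 := by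
    intro i
    rw [← Equiv.sum_comp (ψ (i + 1))]
    refine Finset.sum_congr rfl fun κ _ => ?_
    have := hm κ (i + 1)
    congr 1
    rw [eq_iff_iff, ← and_assoc]
    refine and_congr_left fun _ => ?_
    omega
  simp only [h1]
  rw [Finset.sum_comm]
  refine Finset.sum_congr rfl fun κ _ => ?_
  rw [sum_range_ite_window (hmN κ)]
  simp only [zero_add]

/-- The tableau of a union of columns, expressed by the counting functions of its chains and of
finitely many empty columns. -/
theorem Tableau.HasColumns.exists_rowLen_eq (h : Γ.HasColumns a b n) (hab : ∀ c, a c ≤ b c)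
    (hn : ∀ c, b c ≤ n c + a c) (hm : ∀ κ i, i < m κ ↔ a (ψ i κ) ≤ i ∧ i < b (ψ i κ))
    (heq : ∀ κ i, i + 1 < m κ → a (ψ (i + 1) κ) ≤ i → ψ i κ = ψ (i + 1) κ) :
    ∃ (t : ℕ) (z : Fin t → ℕ), ∀ k r,
      (Γ.diag k).rowLen r + ∑ κ, mergeCount (m κ) (chainRow b n ψ m κ) r
        = (∑ κ, boxCount (m κ) (chainRow b n ψ m κ) k r) + ∑ j, if r < z j then 1 else 0 := by
  -- The empty columns needed are those lost by gluing different columns of a chain, together with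
  -- the entry-free columns of Γ. The value 0 marks absent ones.
  obtain ⟨t, z, hz⟩ := exists_fin_count (J := Σ κ, Fin (m κ))
    (fun j => if j.2 + 1 < m j.1 ∧
        chainRow b n ψ m j.1 (j.2 + 1) = chainRow b n ψ m j.1 j.2 + 1 ∧
        ¬ a (ψ (j.2 + 1) j.1) ≤ j.2 then chainRow b n ψ m j.1 j.2 + 1 else 0)
    fun c => if a c = b c then n c else 0
  refine ⟨t, z, fun k r => ?_⟩
  rw [← hz, Fintype.sum_sigma, h k r]
  dsimp only
  have hN : ∀ c, b c ≤ Finset.univ.sup b := fun c => Finset.le_sup (Finset.mem_univ c)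
  have hcol := Finset.sum_congr (rfl : (Finset.univ : Finset ι) = Finset.univ)
    fun c _ => columnHeight_count (hab c) (hn c) (hN c) k r
  rw [Finset.sum_add_distrib, Finset.sum_add_distrib,
    sum_boxes_eq_sum_chains hN hm
      (fun c i => r < n c + i - b c + (if i < k then 1 else 0)),
    sum_inner_boxes_eq_sum_chains hN hm (fun c i => r < n c + i - b c + 1)] at hcol
  have hbox : (∑ κ, boxCount (m κ) (chainRow b n ψ m κ) k r) = ∑ κ, ∑ i ∈ Finset.range (m κ),
      if r < n (ψ i κ) + i - b (ψ i κ) + (if i < k then 1 else 0) then 1 else 0 := by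
    refine Finset.sum_congr rfl fun κ _ => Finset.sum_congr rfl fun i hi => ?_
    rw [chainRow_of_lt (Finset.mem_range.mp hi)]
  have hempty : (∑ c, if r < (if a c = b c then n c else 0) then 1 else 0)
      = ∑ c, if a c = b c ∧ r < n c then 1 else 0 := by
    refine Finset.sum_congr rfl fun c _ => ?_
    split_ifs <;> omega
  have hmerge : (∑ κ, mergeCount (m κ) (chainRow b n ψ m κ) r)
      = (∑ κ, ∑ i ∈ Finset.range (m κ), if (i + 1 < m κ ∧ a (ψ (i + 1) κ) ≤ i) ∧
          r < n (ψ (i + 1) κ) + i - b (ψ (i + 1) κ) + 1 then 1 else 0)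
        + ∑ κ, ∑ i : Fin (m κ), if r < (if i + 1 < m κ ∧
            chainRow b n ψ m κ (i + 1) = chainRow b n ψ m κ i + 1 ∧
            ¬ a (ψ (i + 1) κ) ≤ i then chainRow b n ψ m κ i + 1 else 0) then 1 else 0 := by
    rw [← Finset.sum_add_distrib]
    refine Finset.sum_congr rfl fun κ _ => ?_
    rw [Fin.sum_univ_eq_sum_range (fun i => if r < (if i + 1 < m κ ∧
            chainRow b n ψ m κ (i + 1) = chainRow b n ψ m κ i + 1 ∧
            ¬ a (ψ (i + 1) κ) ≤ i then chainRow b n ψ m κ i + 1 else 0) then 1 else 0) (m κ),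
      mergeCount, ← Finset.sum_add_distrib]
    refine Finset.sum_congr rfl fun i hi => ?_
    by_cases h1 : i + 1 < m κ
    · by_cases h2 : a (ψ (i + 1) κ) ≤ i
      · have h3 := heq κ i h1 h2
        have h4 := chainRow_of_lt (b := b) (n := n) (ψ := ψ) h1
        have h5 := chainRow_of_lt (b := b) (n := n) (ψ := ψ) (Finset.mem_range.mp hi)
        rw [h3] at h5
        have h6 := hn (ψ (i + 1) κ)
        have h7 : chainRow b n ψ m κ (i + 1) = chainRow b n ψ m κ i + 1 := by omega
        simp only [h1, h2, h7, h5, true_and, not_true, and_false, if_false, Nat.not_lt_zero,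
          add_zero]
      · simp only [h1, h2, true_and, not_false_eq_true, and_true, and_false, false_and, if_false,
          zero_add]
        split_ifs <;> omega
    · simp only [h1, false_and, if_false, Nat.not_lt_zero, add_zero]
  rw [hbox, hempty, hmerge]
  omega

end Chains

/-! ### Indexing the columns of a box move. -/

theorem Multiset.exists_fin_sum_map_eq {α : Type*} (S : Multiset α) :
    ∃ (t : ℕ) (C : Fin t → α), (∀ j, C j ∈ S) ∧
      ∀ f : α → ℕ, (S.map f).sum = ∑ j, f (C j) := by
  induction S using Quotient.inductionOn with
  | _ l =>
    refine ⟨l.length, fun j => l[j], fun j => List.getElem_mem j.2, fun f => ?_⟩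
    change ((l : Multiset α).map f).sum = _
    rw [Multiset.map_coe, Multiset.sum_coe, ← List.sum_ofFn]
    congr 1
    refine List.ext_getElem (by simp) fun i _ _ => ?_
    simp

theorem columnTableau_rowLen (e f n k r : ℕ) :
    ((columnTableau e f n).diag k).rowLen r = if r < columnHeight e f n k then 1 else 0 :=
  singleColumn_rowLen _ _

/-- The two tableaux of an increasing box move are unions of columns which differ by a move. -/
theorem IncreasingBoxMove.exists_columnMove {Γ Γ' : Tableau} (h : IncreasingBoxMove Γ Γ') :
    ∃ (t : ℕ) (a b n₁ n₂ : Option (Option (Fin t)) → ℕ),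
      ColumnMove a b n₁ n₂ none (some none) ∧ Γ.HasColumns a b n₁ ∧ Γ'.HasColumns a b n₂ := by
  obtain ⟨S, e, f, n, e', f', n', hS, he, hef, hn', hnn, hee, hlen, hΓ, hΓ'⟩ := h.columns
  obtain ⟨t, C, hC, hsum⟩ := S.exists_fin_sum_map_eq
  choose a b m ha hab hm _ hCeq using fun j => hS _ (hC j)
  obtain ⟨e, rfl⟩ := Nat.exists_eq_add_of_le' he
  obtain ⟨e', rfl⟩ : ∃ d, e' = d + 1 := Nat.exists_eq_add_of_le' (by omega)
  have hrow : ∀ j i r, ((C j).diag i).rowLen r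
      = if r < columnHeight (a j - 1 + 1) (b j) (m j) i then 1 else 0 := by
    intro j i r
    rw [hCeq, columnTableau_rowLen, Nat.sub_add_cancel (ha j)]
  refine ⟨t, fun c => c.elim e fun c => c.elim e' fun j => a j - 1,
    fun c => c.elim f fun c => c.elim f' b, fun c => c.elim n fun c => c.elim n' m,
    fun c => c.elim n' fun c => c.elim n m, ?_, ?_, ?_⟩
  · constructor
    · rintro (_ | _ | j) <;> simp only [Option.elim] <;> [omega; omega; skip]
      have := hab j
      omega
    · rintro (_ | _ | j) <;> simp only [Option.elim] <;> [omega; omega; skip]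
      have := hm j
      have := ha j
      omega
    · rintro (_ | _ | j) <;> simp only [Option.elim] <;> [omega; omega; skip]
      have := hm j
      have := ha j
      omega
    · simp only [Option.elim]
      omega
    · simp only [Option.elim]
      omega
    · simp only [Option.elim]
      omega
    · exact hnn
    · rfl
    · rfl
    · rintro (_ | _ | j) h1 h2
      · exact absurd rfl h1
      · exact absurd rfl h2
      · rfl
  · intro i r
    rw [hΓ i r, Multiset.map_cons, Multiset.map_cons, Multiset.sum_cons, Multiset.sum_cons, hsum,
      Fintype.sum_option, Fintype.sum_option, columnTableau_rowLen, columnTableau_rowLen]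
    simp only [hrow]
    rfl
  · intro i r
    rw [hΓ' i r, Multiset.map_cons, Multiset.map_cons, Multiset.sum_cons, Multiset.sum_cons, hsum,
      Fintype.sum_option, Fintype.sum_option, columnTableau_rowLen, columnTableau_rowLen]
    simp only [hrow]
    exact Nat.add_left_comm _ _ _

/-! ### From chains to poles, and the comparison of the two sums. -/

section

variable {ι : Type} {a b n n₁ n₂ : ι → ℕ} {ψ : ℕ → Equiv.Perm ι} {m : ι → ℕ}

theorem IsChainDecomposition.exists_chain (D : IsChainDecomposition a b n₁ n₂ ψ m) {c : ι}
    (hc : a c < b c) : ∃ κ, b c ≤ m κ ∧ ∀ i, a c ≤ i → i < b c → ψ i κ = c := by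
  -- Starting from the chain through the last box of the column, `D.eq` keeps it in the column on
  -- the way up.
  have key : ∀ j, a c + j < b c → ψ (b c - 1 - j) ((ψ (b c - 1)).symm c) = c := by
    intro j
    induction j with
    | zero => exact fun _ => Equiv.apply_symm_apply _ _
    | succ j ih =>
      intro hj
      have h1 := ih (by omega)
      have h2 : b c - 1 - j = b c - 1 - (j + 1) + 1 := by omega
      rw [h2] at h1
      rw [D.eq _ _ ((D.lt_iff _ _).mpr ?_) ?_, h1]
      · rw [h1]
        omega
      · rw [h1]
        omega
  have key' : ∀ i, a c ≤ i → i < b c → ψ i ((ψ (b c - 1)).symm c) = c := by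
    intro i h1 h2
    have := key (b c - 1 - i) (by omega)
    rwa [show b c - 1 - (b c - 1 - i) = i by omega] at this
  refine ⟨_, ?_, key'⟩
  have h1 := key' (b c - 1) (by omega) (by omega)
  have := (D.lt_iff ((ψ (b c - 1)).symm c) (b c - 1)).mpr (by rw [h1]; omega)
  omega

theorem chainRow_lt {κ : ι} {i j : ℕ}
    (h : ∀ i, i + 1 < m κ → chainRow b n ψ m κ i < chainRow b n ψ m κ (i + 1)) (hij : i < j)
    (hj : j < m κ) : chainRow b n ψ m κ i < chainRow b n ψ m κ j := by
  induction j with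
  | zero => omega
  | succ j ih =>
    have h1 := h j hj
    rcases Nat.lt_succ_iff_lt_or_eq.mp hij with h2 | rfl
    · exact (ih h2 (by omega)).trans h1
    · exact h1

theorem IsChainDecomposition.chainRow_lt₁ (D : IsChainDecomposition a b n₁ n₂ ψ m) (κ : ι) (i : ℕ)
    (hi : i + 1 < m κ) : chainRow b n₁ ψ m κ i < chainRow b n₁ ψ m κ (i + 1) := by
  rw [chainRow_of_lt hi, chainRow_of_lt (by omega)]
  exact D.row₁ κ i hi

theorem IsChainDecomposition.chainRow_lt₂ (D : IsChainDecomposition a b n₁ n₂ ψ m) (κ : ι) (i : ℕ)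
    (hi : i + 1 < m κ) : chainRow b n₂ ψ m κ i < chainRow b n₂ ψ m κ (i + 1) := by
  rw [chainRow_of_lt hi, chainRow_of_lt (by omega)]
  exact D.row₂ κ i hi

variable {Λ : Type u} [CommRing Λ] [IsDomain Λ] [IsDiscreteValuationRing Λ]

/-- Empty chains are included with zero counts, so that sums can run over all indices; they yield no
pole. -/
theorem exists_pole_counts {ϖ : Λ} (hϖ : Irreducible ϖ) (m : ℕ) (x : ℕ → ℕ)
    (hx : ∀ i, i + 1 < m → x i < x (i + 1)) :
    ∃ F : ℕ → ℕ → ℕ, (∀ k r, F k r + mergeCount m x r = boxCount m x k r) ∧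
      (0 < m → ∃ P : ModEmbedding Λ, P.IsPole ∧ P.HasHeights ϖ m x ∧ P.HasCounts F) := by
  rcases Nat.eq_zero_or_pos m with rfl | hm
  · exact ⟨fun _ _ => 0, fun k r => by simp [mergeCount, boxCount], fun h => absurd h (lt_irrefl 0)⟩
  · obtain ⟨P, h1, h2, F, h3, h4⟩ := exists_pole_of_heights hϖ hm x hx
    exact ⟨F, h4, fun _ => ⟨P, h1, h2, h3⟩⟩

variable [Fintype ι] [DecidableEq ι]

theorem sum_eq_sum_fin_add {X Y : ι} (hXY : X ≠ Y) {p : ι → Prop} [DecidablePred p] {s : ℕ}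
    (σ : Fin s ≃ {κ // κ ≠ X ∧ κ ≠ Y ∧ p κ}) (f : ι → ℕ) (hf : ∀ κ, ¬ p κ → f κ = 0) :
    ∑ κ, f κ = (∑ j, f (σ j)) + (f X + f Y) := by
  rw [Equiv.sum_comp σ fun κ => f κ, ← Finset.add_sum_erase _ f (Finset.mem_univ X),
    ← Finset.add_sum_erase _ f (Finset.mem_erase.mpr ⟨hXY.symm, Finset.mem_univ Y⟩),
    ← Finset.sum_subtype (Finset.univ.filter fun κ => κ ≠ X ∧ κ ≠ Y ∧ p κ) (by simp) f]
  have h : ∑ κ ∈ Finset.univ.filter (fun κ => κ ≠ X ∧ κ ≠ Y ∧ p κ), f κ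
      = ∑ κ ∈ (Finset.univ.erase X).erase Y, f κ := by
    refine Finset.sum_subset (fun κ hκ => ?_) fun κ h1 h2 => hf κ fun hp => h2 ?_
    · rw [Finset.mem_filter] at hκ
      simp [hκ.2.1, hκ.2.2.1]
    · rw [Finset.mem_erase, Finset.mem_erase] at h1
      simp [h1.1, h1.2.1, hp]
  omega

/-- A union of columns with a decomposition into chains is the tableau of the corresponding sum of
poles and an empty embedding. -/
theorem exists_isTableauOf_sum {Γ : Tableau} {x : ι → ℕ → ℕ} {X Y : ι} (hXY : X ≠ Y)
    {F : ι → ℕ → ℕ → ℕ}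
    (hF : ∀ κ k r, F κ k r + mergeCount (m κ) (x κ) r = boxCount (m κ) (x κ) k r)
    {t : ℕ} {z : Fin t → ℕ} (hz : ∀ k r, (Γ.diag k).rowLen r + ∑ κ, mergeCount (m κ) (x κ) r
      = (∑ κ, boxCount (m κ) (x κ) k r) + ∑ j, if r < z j then 1 else 0)
    {s : ℕ} (σ : Fin s ≃ {κ // κ ≠ X ∧ κ ≠ Y ∧ 0 < m κ}) {Q : Fin s → ModEmbedding Λ}
    {P₁ P₂ : ModEmbedding Λ} (hQ : ∀ j, (Q j).HasCounts (F (σ j))) (hP₁ : P₁.HasCounts (F X))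
    (hP₂ : P₂.HasCounts (F Y)) :
    ∃ E : ModEmbedding Λ, E.IsEmptyEmb ∧
      Γ.IsTableauOf ((ModEmbedding.sum Q).prod ((P₁.prod P₂).prod E)) := by
  obtain ⟨E, hE, hcount⟩ := exists_isEmptyEmb (Λ := Λ) z
  refine ⟨E, hE, ((ModEmbedding.HasCounts.sum hQ).prod
    ((hP₁.prod hP₂).prod hcount)).isTableauOf fun k r => ?_⟩
  have h0 : ∀ κ, ¬ 0 < m κ → F κ k r = 0 := by
    intro κ hκ
    have := hF κ k r
    rw [Nat.eq_zero_of_not_pos hκ] at this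
    simpa [mergeCount, boxCount] using this
  have h1 := sum_eq_sum_fin_add hXY σ (fun κ => F κ k r) h0
  have h2 := hz k r
  simp only [← hF] at h2
  rw [Finset.sum_add_distrib] at h2
  simp only [Pi.add_apply]
  omega

end

theorem mainTheorem11 {Λ : Type u} [CommRing Λ] [IsDomain Λ] [IsDiscreteValuationRing Λ]
    (Γ Γ' : Tableau) (h : IncreasingBoxMove Γ Γ') :
    ∃ (s : ℕ) (Q : Fin s → ModEmbedding Λ) (P₁ P₂ P₁' P₂' E E' : ModEmbedding Λ),
      (∀ i, (Q i).IsPole) ∧ P₁.IsPole ∧ P₂.IsPole ∧ P₁'.IsPole ∧ P₂'.IsPole ∧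
      E.IsEmptyEmb ∧ E'.IsEmptyEmb ∧
      Γ.IsTableauOf ((ModEmbedding.sum Q).prod ((P₁.prod P₂).prod E)) ∧
      Γ'.IsTableauOf ((ModEmbedding.sum Q).prod ((P₁'.prod P₂').prod E')) ∧
      ¬ P₁.Iso P₁' ∧ ¬ P₁.Iso P₂' ∧ ¬ P₂.Iso P₁' ∧ ¬ P₂.Iso P₂' := by
  obtain ⟨ϖ, hϖ⟩ := IsDiscreteValuationRing.exists_irreducible Λ
  obtain ⟨t, a, b, n₁, n₂, H, h₁, h₂⟩ := h.exists_columnMove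
  generalize hX : (none : Option (Option (Fin t))) = X at H
  generalize hY : (some none : Option (Option (Fin t))) = Y at H
  obtain ⟨ψ, m, D⟩ := H.exists_isChainDecomposition h₁ h₂ h.isLR h.isLR'
  have hne := H.nonempty
  have hlt := H.start_lt
  have hlen := H.length_eq
  have hh := H.height_lt
  have hnX := H.height_X
  have hnY := H.height_Y
  have hleX := H.le₂ X
  have hleY := H.le₁ Y
  obtain ⟨κX, hmX, hκX⟩ := D.exists_chain hne
  obtain ⟨κY, hmY, hκY⟩ := D.exists_chain (c := Y) (by omega)
  -- the rows of the smallest entries of the columns `X` and `Y`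
  have hrow : ∀ n c κ, b c ≤ m κ → a c < b c → (∀ i, a c ≤ i → i < b c → ψ i κ = c) →
      chainRow b n ψ m κ (a c) = n c + a c - b c := by
    intro n c κ h1 h2 h3
    rw [chainRow_of_lt (by omega), h3 _ le_rfl h2]
  have hX₁ := hrow n₁ X κX hmX hne hκX
  have hX₂ := hrow n₂ X κX hmX hne hκX
  have hY₁ := hrow n₁ Y κY hmY (by omega) hκY
  have hY₂ := hrow n₂ Y κY hmY (by omega) hκY
  have hlt₁ := chainRow_lt (D.chainRow_lt₁ κY) hlt (by omega)
  have hlt₂ := chainRow_lt (D.chainRow_lt₂ κY) hlt (by omega)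
  -- In a common chain the smallest entry of X would lie above that of Y in Γ, but X and Y have
  -- equally many entries and X is the higher column there.
  have hκ : κX ≠ κY := by
    rintro rfl
    omega
  have hsame : ∀ κ, κ ≠ κX → κ ≠ κY → chainRow b n₂ ψ m κ = chainRow b n₁ ψ m κ := by
    intro κ h1 h2
    ext i
    unfold chainRow
    split_ifs with hi
    · have h3 := (D.lt_iff κ i).mp hi
      rw [H.height_eq]
      · intro h4
        rw [h4] at h3
        exact h1 ((ψ i).injective (h4.trans (hκX i h3.1 h3.2).symm))
      · intro h4
        rw [h4] at h3
        exact h2 ((ψ i).injective (h4.trans (hκY i h3.1 h3.2).symm))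
    · rfl
  choose F hF hP using fun κ => exists_pole_counts hϖ (m κ) _ (D.chainRow_lt₁ κ)
  choose F' hF' hP' using fun κ => exists_pole_counts hϖ (m κ) _ (D.chainRow_lt₂ κ)
  choose P hPole hHeight hCount using hP
  choose P' hPole' hHeight' hCount' using hP'
  obtain ⟨t₁, z₁, hz₁⟩ := h₁.exists_rowLen_eq H.le H.le₁ D.lt_iff D.eq
  obtain ⟨t₂, z₂, hz₂⟩ := h₂.exists_rowLen_eq H.le H.le₂ D.lt_iff D.eq
  have hmX0 : 0 < m κX := by omega
  have hmY0 : 0 < m κY := by omega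
  let σ := (Fintype.equivFin {κ // κ ≠ κX ∧ κ ≠ κY ∧ 0 < m κ}).symm
  let Q := fun j => P (σ j) (σ j).2.2.2
  obtain ⟨E, hE, hΓ⟩ := exists_isTableauOf_sum hκ hF hz₁ σ (Q := Q) (fun j => hCount _ _)
    (hCount κX hmX0) (hCount κY hmY0)
  -- Away from the two special chains the rows agree, so the counts of the poles chosen for Γ are
  -- reused and both sums share the same `Q`.
  have hG : ∀ κ k r, (if κ = κX ∨ κ = κY then F' κ else F κ) k r
      + mergeCount (m κ) (chainRow b n₂ ψ m κ) r = boxCount (m κ) (chainRow b n₂ ψ m κ) k r := by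
    intro κ k r
    split_ifs with h1
    · exact hF' κ k r
    · rw [not_or] at h1
      rw [hsame κ h1.1 h1.2]
      exact hF κ k r
  obtain ⟨E', hE', hΓ'⟩ := exists_isTableauOf_sum hκ hG hz₂ σ (Q := Q) (P₁ := P' κX hmX0)
    (P₂ := P' κY hmY0)
    (fun j => by
      rw [if_neg (not_or.mpr ⟨(σ j).2.1, (σ j).2.2.1⟩)]
      exact hCount _ _)
    (by
      rw [if_pos (Or.inl rfl)]
      exact hCount' κX hmX0)
    (by
      rw [if_pos (Or.inr rfl)]
      exact hCount' κY hmY0)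
  refine ⟨_, Q, _, _, _, _, E, E', fun j => hPole _ _, hPole κX hmX0, hPole κY hmY0,
    hPole' κX hmX0, hPole' κY hmY0, hE, hE', hΓ, hΓ', ?_, ?_, ?_, ?_⟩
  -- The starting rows of X and Y are exchanged. For the mixed pairs the comparison at `a X` also
  -- uses that the chain of Y is at that entry strictly above its row at `a Y`.
  · exact (hHeight κX hmX0).not_iso (hHeight' κX hmX0) (k := a X) (by omega) (by omega) (by omega)
  · exact (hHeight κX hmX0).not_iso (hHeight' κY hmY0) (k := a X) (by omega) (by omega) (by omega)
  · exact (hHeight κY hmY0).not_iso (hHeight' κX hmX0) (k := a X) (by omega) (by omega) (by omega)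
  · exact (hHeight κY hmY0).not_iso (hHeight' κY hmY0) (k := a Y) (by omega) (by omega) (by omega)
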